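/- Let $X$ be a metric space with its Borel $\sigma$-algebra, let $\sigma$ be a finite non-zero measure on $X$ with $\sigma(\{x\})=0$ for all $x\in X$, let $\Omega$ be the set of Radon measures on $X$ of the form $\omega=\sum_{i=1}^N\delta_{x_i}$ with $N\in\mathbb N\cup\{\infty\}$ and pairwise distinct $x_i\in X$ (identified with the sets $\{x_i\}$), equipped with the $\sigma$-algebra generated by the maps $\omega\mapsto\omega(B)$, $B\subset X$ Borel, and let $\pi$ be the Poisson measure on $\Omega$ with intensity $\sigma$, i.e. for all disjoint Borel sets $A_1,\dots,A_n$ and all $k_1,\dots,k_n\in\mathbb N$, $$\pi(\omega(A_1)=k_1,\dots,\omega(A_n)=k_n)=\prod_{i=1}^n\frac{\sigma(A_i)^{k_i}}{k_i!}e^{-\sigma(A_i)}.$$ For $F:\Omega\to\mathbb R$ let $D_xF(\omega)=F(\omega)-F(\omega+\delta_x)$ if $x\notin\omega$ and $D_xF(\omega)=F(\omega)-F(\omega-\delta_x)$ if $x\in\omega$, and let $|DF(\omega)|_{\infty}=|DF(\omega)|_{L^\infty(\frac{\sigma+\omega}{2})}$ be the essential supremum of $x\mapsto|D_xF(\omega)|$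 with respect to $\frac{\sigma+\omega}{2}$. Let $$\lambda_\infty=\inf_F\frac{E[|DF|_\infty^2]}{\operatorname{Var}(F)},\qquad h_\infty=\inf_{0<\pi(A)<\frac12}\frac{E[|D1_A|_\infty]}{\pi(A)},$$ where $F$ runs over the measurable square-integrable functions on $\Omega$ that are not almost surely constant, $A$ runs over the measurable subsets of $\Omega$, and $E$ and $\operatorname{Var}$ are taken under $\pi$. (Here $|D1_A|_\infty$ is the indicator function of the boundary $\partial A$ of $A$, the set of those $\omega\in A$ that have a neighbour $\omega-\delta_x\notin A$, $x\in\omega$, or a $\sigma$-non-negligible set of $x$ with $\omega+\delta_x\notin A$, together with those $\omega\notin A$ for which the same holds with $A$ and its complement exchanged; thus $h_\infty=\inf_{0<\pi(A)<1/2}\pi(\partial A)/\pi(A)$.) Then $$\lambda_\infty=\frac{1}{\sigma(X)}\ \ge\ \frac{(\sqrt{h_\infty+1}-1)^2}{4}.$$ -/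

import Mathlib

open MeasureTheory ProbabilityTheory
open scoped ENNReal

/-- A configuration of points of `X`: the support of a Radon measure `∑ i, δ_{x_i}`, where the
(finitely or countably many) points `x_i` are pairwise distinct. -/
@[ext]
structure Configuration (X : Type*) [TopologicalSpace X] where
  carrier : Set X
  countable : carrier.Countable
  finite_inter : ∀ K : Set X, IsCompact K → (carrier ∩ K).Finite

namespace Configuration

variable {X : Type*} [TopologicalSpace X]

/-- `ω + δ_x` (for `x ∉ ω`), i.e. `ω ∪ {x}`. -/
def addPoint (ω : Configuration X) (x : X) : Configuration X where
  carrier := insert x ω.carrier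
  countable := ω.countable.insert x
  finite_inter K hK := ((ω.finite_inter K hK).insert x).subset (by
    rintro y ⟨rfl | hy, hyK⟩
    · exact Set.mem_insert _ _
    · exact Set.mem_insert_of_mem _ ⟨hy, hyK⟩)

/-- `ω - δ_x` (for `x ∈ ω`), i.e. `ω \ {x}`. -/
def removePoint (ω : Configuration X) (x : X) : Configuration X where
  carrier := ω.carrier \ {x}
  countable := ω.countable.mono Set.sdiff_subset
  finite_inter K hK := (ω.finite_inter K hK).subset
    (Set.inter_subset_inter_left K Set.sdiff_subset)

/-- `ω(B)`, the number of points of `ω` in `B`. -/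
noncomputable def number (ω : Configuration X) (B : Set X) : ℕ∞ := (ω.carrier ∩ B).encard

/-- The σ-algebra on configurations generated by the maps `ω ↦ ω(B)`, `B` measurable. -/
noncomputable instance instMeasurableSpace [MeasurableSpace X] : MeasurableSpace (Configuration X) :=
  ⨆ (B : Set X) (_ : MeasurableSet B), MeasurableSpace.comap (fun ω => number ω B) ⊤

/-- The configuration `ω` regarded as the measure `∑_{x ∈ ω} δ_x` on `X`. -/
noncomputable def toMeasure [MeasurableSpace X] (ω : Configuration X) : Measure X :=
  Measure.sum fun x : ω.carrier => Measure.dirac (x : X)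

open Classical in
/-- The finite difference gradient: `D_x F(ω) = F(ω) - F(ω + δ_x)` if `x ∉ ω`, and
`D_x F(ω) = F(ω) - F(ω - δ_x)` if `x ∈ ω`. -/
noncomputable def grad (F : Configuration X → ℝ) (ω : Configuration X) (x : X) : ℝ :=
  if x ∈ ω.carrier then F ω - F (ω.removePoint x) else F ω - F (ω.addPoint x)

variable [MeasurableSpace X]

/-- `|DF(ω)|_{L^p((σ + ω)/2)}`. -/
noncomputable def gradNorm (σ : Measure X) (p : ℝ≥0∞) (F : Configuration X → ℝ)
    (ω : Configuration X) : ℝ≥0∞ :=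
  eLpNorm (grad F ω) p ((2⁻¹ : ℝ≥0∞) • (σ + ω.toMeasure))

/-- `π` is the Poisson measure with intensity `σ`: the numbers of points in disjoint measurable
sets `A_1, …, A_n` are independent Poisson variables with parameters `σ(A_1), …, σ(A_n)`. -/
def IsPoissonMeasure (σ : Measure X) (π : Measure (Configuration X)) : Prop :=
  ∀ (n : ℕ) (A : Fin n → Set X), (∀ i, MeasurableSet (A i)) →
    Pairwise (fun i j => Disjoint (A i) (A j)) → ∀ k : Fin n → ℕ,
      π {ω | ∀ i, ω.number (A i) = k i} =
        ENNReal.ofReal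
          (∏ i, σ.real (A i) ^ k i / (k i).factorial * Real.exp (-σ.real (A i)))

/-- The two-sided isoperimetric constant `h_p`: the infimum over the measurable sets `A` with
`0 < π(A) < 1/2` of `E[|D 1_A|_{L^p((σ + ω)/2)}] / π(A)`. For `p = ∞` the numerator is the
`π`-measure of the boundary of `A`. -/
noncomputable def isoperimetricConstant (σ : Measure X) (π : Measure (Configuration X))
    (p : ℝ≥0∞) : ℝ≥0∞ :=
  ⨅ (A : Set (Configuration X)) (_ : MeasurableSet A) (_ : 0 < π A) (_ : π A < 1 / 2),
    (∫⁻ ω, gradNorm σ p (A.indicator fun _ => 1) ω ∂π) / π A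

/-- The Poincaré constant `λ_p`: the infimum over the square-integrable functions `F` that are
not almost surely constant of `E[|DF|_{L^p((σ + ω)/2)}^2] / Var(F)`. -/
noncomputable def poincareConstant (σ : Measure X) (π : Measure (Configuration X))
    (p : ℝ≥0∞) : ℝ≥0∞ :=
  ⨅ (F : Configuration X → ℝ) (_ : Measurable F) (_ : MemLp F 2 π) (_ : evariance F π ≠ 0),
    (∫⁻ ω, gradNorm σ p F ω ^ 2 ∂π) / evariance F π

end Configuration

/-! ### Efron–Stein inequality for convolution powers. -/

section ConvolutionPowers

variable {V : Type*} [MeasurableSpace V]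

/-! Write r = σ(X) and N for the total number of points. The value of λ_∞ comes from the Poincaré
inequality Var F ≤ E ∫ |D_x F|² dσ(x), whose right side is at most r E|DF|_∞². So λ_∞ ≥ 1/r, and N
attains the bound: its jumps are ±1 and its variance is r.

To prove the Poincaré inequality, regard configurations as random measures. The Poisson law of
intensity σ is then a convolution of j + 1 copies of the law of intensity hσ, h = 1/(j+1).
Efron–Stein bounds the variance by j + 1 times the mean squared effect of adding one copy. To first
order in h, a copy is a single point with law hσ, and j → ∞ gives the inequality
(`variance_conv_pow_le`, `lintegral_poissonLaw_le`, `evariance_poissonLaw_le`). The semigroup law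
and the identification with π both use uniqueness of the characteristic functional.

Since λ_∞ is explicit, the second claim needs no general Cheeger argument: it reduces to an upper
bound on h_∞. Testing on events {N ∈ S} leaves a vertex isoperimetric problem for the Poisson
distribution on ℕ. Let d be the distance to a median. Applying isoperimetry to the tails on both
sides and summing with weights 2j + 1 gives h_∞ E d² ≤ 4 E d + 2. As E d² ≥ r and E d ≤ √(E d²),
this yields h_∞ ≤ 4/√r + 2/r ≤ (1 + 2/√r)² − 1, which is the claim. -/

theorem integrable_of_measurable_of_abs_le {P : Measure V} [IsFiniteMeasure P] {F : V → ℝ}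
    (hF : Measurable F) {C : ℝ} (hC : ∀ v, |F v| ≤ C) : Integrable F P :=
  Integrable.of_bound hF.aestronglyMeasurable C (Filter.Eventually.of_forall hC)

theorem abs_integral_le_of_abs_le {P : Measure V} [IsProbabilityMeasure P] {F : V → ℝ}
    {C : ℝ} (hC : ∀ v, |F v| ≤ C) : |∫ v, F v ∂P| ≤ C := by
  have := norm_integral_le_of_norm_le_const (μ := P) (f := F) (C := C)
    (Filter.Eventually.of_forall hC)
  simpa using this

theorem abs_sq_le_of_abs_le {x C : ℝ} (h : |x| ≤ C) : |x ^ 2| ≤ C ^ 2 := by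
  rw [abs_pow]
  exact pow_le_pow_left₀ (abs_nonneg _) h 2

/-- Variance plus squared bias. Taking for c the value before an increment bounds a conditional
variance by the mean squared increment. -/
theorem integral_sub_const_sq {P : Measure V} [IsProbabilityMeasure P] {Y : V → ℝ}
    (hY : Measurable Y) {C : ℝ} (hC : ∀ v, |Y v| ≤ C) (c : ℝ) :
    ∫ v, (Y v - c) ^ 2 ∂P = ∫ v, Y v ^ 2 ∂P - (∫ v, Y v ∂P) ^ 2 + (∫ v, Y v ∂P - c) ^ 2 := by
  have h1 : Integrable (fun v => Y v ^ 2) P :=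
    integrable_of_measurable_of_abs_le (hY.pow_const 2) fun v => abs_sq_le_of_abs_le (hC v)
  have h2 : Integrable Y P := integrable_of_measurable_of_abs_le hY hC
  have h3 : ∀ v, (Y v - c) ^ 2 = Y v ^ 2 - 2 * c * Y v + c ^ 2 := fun v => by ring
  simp_rw [h3]
  have h4 : Integrable (fun v => Y v ^ 2 - 2 * c * Y v) P := h1.sub (h2.const_mul _)
  rw [integral_add h4 (integrable_const _), integral_sub h1 (h2.const_mul _), integral_const_mul]
  simp
  ring

theorem sq_integral_le_integral_sq {P : Measure V} [IsProbabilityMeasure P] {Y : V → ℝ}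
    (hY : Measurable Y) {C : ℝ} (hC : ∀ v, |Y v| ≤ C) :
    (∫ v, Y v ∂P) ^ 2 ≤ ∫ v, Y v ^ 2 ∂P := by
  have h := integral_sub_const_sq (P := P) hY hC (∫ v, Y v ∂P)
  have h0 : 0 ≤ ∫ v, (Y v - ∫ v, Y v ∂P) ^ 2 ∂P := integral_nonneg fun v => sq_nonneg _
  rw [h] at h0
  simpa using h0

variable [AddCommMonoid V] [MeasurableAdd₂ V]

theorem integral_conv_of_abs_le {P Q : Measure V} [IsProbabilityMeasure P]
    [IsProbabilityMeasure Q] {F : V → ℝ} (hF : Measurable F) {C : ℝ} (hC : ∀ v, |F v| ≤ C) :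
    ∫ v, F v ∂(P ∗ Q) = ∫ v, ∫ w, F (v + w) ∂Q ∂P :=
  integral_conv (integrable_of_measurable_of_abs_le hF hC)

/-- An Efron–Stein type bound: the variance under the `(j + 1)`-st convolution power is at most
`j + 1` times the mean squared increment. -/
theorem variance_conv_pow_le {P : ℕ → Measure V} [∀ j, IsProbabilityMeasure (P j)]
    (h0 : P 0 = Measure.dirac 0) (hP : ∀ j, P (j + 1) = P j ∗ P 1) (j : ℕ) :
    ∀ {F : V → ℝ}, Measurable F → ∀ {C : ℝ}, (∀ v, |F v| ≤ C) →
      ∫ v, F v ^ 2 ∂(P (j + 1)) - (∫ v, F v ∂(P (j + 1))) ^ 2 ≤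
        (j + 1) * ∫ v, ∫ w, (F (v + w) - F v) ^ 2 ∂(P 1) ∂(P j) := by
  have hmeas : ∀ {F : V → ℝ}, Measurable F →
      Measurable (fun p : V × V => (F (p.1 + p.2) - F p.1) ^ 2) := fun hF =>
    ((hF.comp (measurable_fst.add measurable_snd)).sub (hF.comp measurable_fst)).pow_const 2
  have hint : ∀ {h : V × V → ℝ}, Measurable h → Measurable fun v => ∫ w, h (v, w) ∂(P 1) :=
    fun hh => (hh.stronglyMeasurable.integral_prod_right').measurable
  induction j with
  | zero =>
    intro F hF C hC
    have h1 := integral_sub_const_sq (P := P 1) hF hC (F 0)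
    have h2 := sq_nonneg (∫ v, F v ∂(P 1) - F 0)
    rw [h0, integral_dirac' _ _ (hint (hmeas hF)).stronglyMeasurable]
    simp only [zero_add, Nat.cast_zero, one_mul, h1]
    linarith
  | succ j ih =>
    intro F hF C hC
    have hFw : ∀ v, Measurable fun w => F (v + w) := fun v => hF.comp (measurable_const_add v)
    -- Condition on the first j + 1 summands: g is the conditional mean and q − g² the conditional
    -- variance, at most Γ. The induction hypothesis handles the variance of g.
    set g : V → ℝ := fun v => ∫ w, F (v + w) ∂(P 1) with hg
    have hgm : Measurable g := hint (h := fun p => F (p.1 + p.2))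
      (hF.comp (measurable_fst.add measurable_snd))
    have hgC : ∀ v, |g v| ≤ C := fun v => abs_integral_le_of_abs_le fun w => hC _
    set Γ : V → ℝ := fun v => ∫ w, (F (v + w) - F v) ^ 2 ∂(P 1) with hΓ
    have hD : ∀ v w, |F (v + w) - F v| ≤ 2 * C := fun v w =>
      (abs_sub _ _).trans (by linarith [hC (v + w), hC v])
    have hD2 : ∀ v w, |(F (v + w) - F v) ^ 2| ≤ (2 * C) ^ 2 := fun v w =>
      abs_sq_le_of_abs_le (hD v w)
    have hΓm : Measurable Γ := hint (hmeas hF)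
    have hΓC : ∀ v, |Γ v| ≤ (2 * C) ^ 2 := fun v => abs_integral_le_of_abs_le fun w => hD2 v w
    have hF2 : Measurable fun v => F v ^ 2 := hF.pow_const 2
    have hF2C : ∀ v, |F v ^ 2| ≤ C ^ 2 := fun v => abs_sq_le_of_abs_le (hC v)
    set q : V → ℝ := fun v => ∫ w, F (v + w) ^ 2 ∂(P 1) with hq
    have hqm : Measurable q := hint (h := fun p => F (p.1 + p.2) ^ 2)
      (hF2.comp (measurable_fst.add measurable_snd))
    have hqC : ∀ v, |q v| ≤ C ^ 2 := fun v => abs_integral_le_of_abs_le fun w => hF2C _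
    have e1 : ∫ v, F v ∂(P (j + 1 + 1)) = ∫ v, g v ∂(P (j + 1)) := by
      rw [hP (j + 1)]; exact integral_conv_of_abs_le hF hC
    have e2 : ∫ v, F v ^ 2 ∂(P (j + 1 + 1)) = ∫ v, q v ∂(P (j + 1)) := by
      rw [hP (j + 1)]; exact integral_conv_of_abs_le hF2 hF2C
    have hpt : ∀ v, q v - g v ^ 2 ≤ Γ v := fun v => by
      have h1 := integral_sub_const_sq (P := P 1) (hFw v) (fun w => hC _) (F v)
      have h2 := sq_nonneg (∫ w, F (v + w) ∂(P 1) - F v)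
      simp only [hΓ, hq, hg]
      linarith
    have iq : Integrable q (P (j + 1)) := integrable_of_measurable_of_abs_le hqm hqC
    have ig2 : Integrable (fun v => g v ^ 2) (P (j + 1)) :=
      integrable_of_measurable_of_abs_le (hgm.pow_const 2) fun v => abs_sq_le_of_abs_le (hgC v)
    have iΓ : Integrable Γ (P (j + 1)) := integrable_of_measurable_of_abs_le hΓm hΓC
    have s1 : ∫ v, q v ∂(P (j + 1)) - ∫ v, g v ^ 2 ∂(P (j + 1)) ≤ ∫ v, Γ v ∂(P (j + 1)) := by
      rw [← integral_sub iq ig2]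
      exact integral_mono (iq.sub ig2) iΓ hpt
    have s2 := ih hgm hgC
    -- Averaging over a summand does not increase mean squared increments: apply Jensen to the
    -- increment of g, then Fubini, so that the averaged summand u joins `P j` to form `P (j + 1)`.
    have s3 : ∫ v, ∫ w, (g (v + w) - g v) ^ 2 ∂(P 1) ∂(P j) ≤ ∫ v, Γ v ∂(P (j + 1)) := by
      rw [hP j, integral_conv_of_abs_le hΓm hΓC]
      have hgD : ∀ v w, |(g (v + w) - g v) ^ 2| ≤ (2 * C) ^ 2 := fun v w =>
        abs_sq_le_of_abs_le ((abs_sub _ _).trans (by linarith [hgC (v + w), hgC v]))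
      refine integral_mono
        (integrable_of_measurable_of_abs_le (hint (hmeas hgm))
          fun v => abs_integral_le_of_abs_le (hgD v))
        (integrable_of_measurable_of_abs_le
          (hint (h := fun p => Γ (p.1 + p.2)) (hΓm.comp (measurable_fst.add measurable_snd)))
          fun v => abs_integral_le_of_abs_le fun w => hΓC _) fun v => ?_
      have hk : Measurable fun p : V × V => (F (v + p.1 + p.2) - F (v + p.1)) ^ 2 :=
        ((hF.comp ((measurable_fst.const_add v).add measurable_snd)).sub
          (hF.comp (measurable_fst.const_add v))).pow_const 2
      have hswap : ∫ u, Γ (v + u) ∂(P 1) =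
          ∫ w, ∫ u, (F (v + u + w) - F (v + u)) ^ 2 ∂(P 1) ∂(P 1) := by
        simp only [hΓ]
        exact integral_integral_swap
          (integrable_of_measurable_of_abs_le hk fun p => hD2 _ _)
      rw [hswap]
      refine integral_mono
        (integrable_of_measurable_of_abs_le
          (((hgm.comp (measurable_const_add v)).sub_const _).pow_const 2) (hgD v))
        (integrable_of_measurable_of_abs_le
          (hint (h := fun p => (F (v + p.2 + p.1) - F (v + p.2)) ^ 2)
            (hk.comp measurable_swap)) fun w => abs_integral_le_of_abs_le fun u => hD2 _ _)
        fun w => ?_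
      have hdiff : g (v + w) - g v = ∫ u, (F (v + u + w) - F (v + u)) ∂(P 1) := by
        simp only [hg]
        rw [← integral_sub (integrable_of_measurable_of_abs_le (hFw _) fun u => hC _)
          (integrable_of_measurable_of_abs_le (hFw _) fun u => hC _)]
        simp_rw [add_right_comm v w]
      simp only [hdiff]
      exact sq_integral_le_integral_sq
        ((hF.comp ((measurable_const_add v).add_const w)).sub (hFw v)) fun u => hD _ _
    rw [e1, e2]
    push_cast
    nlinarith [s1, s2, mul_le_mul_of_nonneg_left s3 (by positivity : (0 : ℝ) ≤ (j : ℝ) + 1)]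

end ConvolutionPowers

/-! ### Uniqueness of the law of a random measure. -/

section CharacteristicFunctional

theorem finite_range_sum_mul_indicator {X ι : Type*} [Fintype ι] (B : ι → Set X) (t : ι → ℝ) :
    (Set.range fun x => ∑ i, t i * (B i).indicator (fun _ => (1 : ℝ)) x).Finite := by
  refine (Set.finite_range fun s : Set ι => ∑ i, t i * s.indicator (fun _ => (1 : ℝ)) i).subset ?_
  rintro _ ⟨x, rfl⟩
  exact ⟨{i | x ∈ B i}, Finset.sum_congr rfl fun i _ => by simp [Set.indicator]⟩

variable {X : Type*} [MeasurableSpace X]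

theorem measurable_measureReal_apply {B : Set X} (hB : MeasurableSet B) :
    Measurable fun v : Measure X => v.real B :=
  (Measure.measurable_coe hB).ennreal_toReal

theorem integral_sum_mul_indicator {ι : Type*} [Fintype ι] {B : ι → Set X}
    (hB : ∀ i, MeasurableSet (B i)) (t : ι → ℝ) (v : Measure X) [IsFiniteMeasure v] :
    ∫ x, ∑ i, t i * (B i).indicator (fun _ => (1 : ℝ)) x ∂v = ∑ i, t i * v.real (B i) := by
  rw [integral_finsetSum _ fun i _ =>
    ((integrable_const (1 : ℝ)).indicator (hB i)).const_mul (t i)]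
  refine Finset.sum_congr rfl fun i _ => ?_
  rw [integral_const_mul, integral_indicator_const _ (hB i)]
  simp

/-- For f = ∑ tᵢ 1_{Bᵢ} the functional is the characteristic function at t of the vector (v(Bᵢ)), so
finite-dimensional uniqueness applies. -/
theorem map_measureReal_eq_of_charFunctional {P Q : Measure (Measure X)} [IsProbabilityMeasure P]
    [IsProbabilityMeasure Q] (hP : ∀ᵐ v ∂P, v Set.univ < ∞) (hQ : ∀ᵐ v ∂Q, v Set.univ < ∞)
    (h : ∀ f : X → ℝ, Measurable f → (Set.range f).Finite →
      ∫ v, Complex.exp ((∫ x, f x ∂v : ℝ) * Complex.I) ∂P =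
        ∫ v, Complex.exp ((∫ x, f x ∂v : ℝ) * Complex.I) ∂Q)
    {ι : Type*} [Fintype ι] {B : ι → Set X} (hB : ∀ i, MeasurableSet (B i)) :
    P.map (fun v i => v.real (B i)) = Q.map (fun v i => v.real (B i)) := by
  have hm : Measurable fun (v : Measure X) i => v.real (B i) :=
    measurable_pi_lambda _ fun i => measurable_measureReal_apply (hB i)
  have hm' : Measurable fun v : Measure X => WithLp.toLp 2 fun i => v.real (B i) :=
    (WithLp.measurable_toLp 2 _).comp hm
  have key : P.map (fun v => WithLp.toLp 2 fun i => v.real (B i)) =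
      Q.map (fun v => WithLp.toLp 2 fun i => v.real (B i)) := by
    have : IsProbabilityMeasure (P.map (fun v => WithLp.toLp 2 fun i => v.real (B i))) :=
      Measure.isProbabilityMeasure_map hm'.aemeasurable
    have : IsProbabilityMeasure (Q.map (fun v => WithLp.toLp 2 fun i => v.real (B i))) :=
      Measure.isProbabilityMeasure_map hm'.aemeasurable
    refine Measure.ext_of_charFun (E := EuclideanSpace ℝ ι) (funext fun t => ?_)
    have aux : ∀ {ρ : Measure (Measure X)}, (∀ᵐ v ∂ρ, v Set.univ < ∞) →
        charFun (ρ.map (fun v => WithLp.toLp 2 fun i => v.real (B i)) :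
          Measure (EuclideanSpace ℝ ι)) t =
        ∫ v, Complex.exp ((∫ x, ∑ i, t i * (B i).indicator (fun _ => (1 : ℝ)) x ∂v : ℝ)
          * Complex.I) ∂ρ := by
      intro ρ hR
      rw [charFun_apply, integral_map hm'.aemeasurable (by fun_prop)]
      refine integral_congr_ae (hR.mono fun v hv => ?_)
      have : IsFiniteMeasure v := ⟨hv⟩
      simp only [integral_sum_mul_indicator hB]
      simp [PiLp.inner_apply]
    rw [aux hP, aux hQ]
    refine h _ ?_ (finite_range_sum_mul_indicator B t)
    exact Finset.measurable_sum _ fun i _ => (measurable_const.indicator (hB i)).const_mul _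
  have hid : (fun (v : Measure X) i => v.real (B i)) =
      WithLp.ofLp ∘ (fun v => WithLp.toLp 2 fun i => v.real (B i)) := rfl
  rw [hid, ← Measure.map_map (WithLp.measurable_ofLp 2 _) hm', key,
    Measure.map_map (WithLp.measurable_ofLp 2 _) hm']

/-- The law of an almost surely finite random measure is determined by its characteristic
functional on finitely valued functions. -/
theorem ext_of_charFunctional {P Q : Measure (Measure X)} [IsProbabilityMeasure P]
    [IsProbabilityMeasure Q] (hP : ∀ᵐ v ∂P, v Set.univ < ∞) (hQ : ∀ᵐ v ∂Q, v Set.univ < ∞)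
    (h : ∀ f : X → ℝ, Measurable f → (Set.range f).Finite →
      ∫ v, Complex.exp ((∫ x, f x ∂v : ℝ) * Complex.I) ∂P =
        ∫ v, Complex.exp ((∫ x, f x ∂v : ℝ) * Complex.I) ∂Q) :
    P = Q := by
  let m : {B : Set X // MeasurableSet B} → MeasurableSpace (Measure X) := fun B =>
    (borel ℝ≥0∞).comap fun v => v B.1
  have hgen : (Measure.instMeasurableSpace : MeasurableSpace (Measure X)) =
      MeasurableSpace.generateFrom (piiUnionInter (fun B => {s | MeasurableSet[m B] s})
        Set.univ) := by
    refine Eq.trans ?_ (generateFrom_piiUnionInter_measurableSet m Set.univ).symm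
    simp only [Set.mem_univ, iSup_pos]
    rw [iSup_subtype]
    rfl
  -- Finite cylinders {v : v(B) ∈ T_B for B ∈ t} form a generating π-system, and their measures
  -- depend only on finite-dimensional laws.
  refine ext_of_generate_finite _ hgen (isPiSystem_piiUnionInter _
    (fun B => @MeasurableSpace.isPiSystem_measurableSet _ (m B)) _) ?_ (by simp)
  rintro _ ⟨t, -, S, hS, rfl⟩
  choose! T hT hTS using hS
  have aux : ∀ {ρ : Measure (Measure X)}, (∀ᵐ v ∂ρ, v Set.univ < ∞) →
      ρ (⋂ B ∈ t, S B) = ρ.map (fun v (B : t) => v.real B.1.1)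
        {y | ∀ B : t, ENNReal.ofReal (y B) ∈ T B.1} := by
    intro ρ hR
    rw [Measure.map_apply (measurable_pi_lambda _ fun B => measurable_measureReal_apply B.1.2)]
    · refine measure_congr (hR.mono fun v hv => propext ?_)
      have hfin : ∀ B, v B ≠ ∞ := fun B => ((measure_mono (Set.subset_univ B)).trans_lt hv).ne
      change v ∈ (⋂ B ∈ t, S B) ↔
        v ∈ (fun v (B : t) => v.real B.1.1) ⁻¹' {y | ∀ B : t, ENNReal.ofReal (y B) ∈ T B.1}
      simp only [Set.mem_iInter, Set.mem_preimage, Set.mem_ofPred_eq, Subtype.forall]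
      refine forall_congr' fun B => forall_congr' fun hB => forall_congr' fun hBt => ?_
      rw [← hTS ⟨B, hB⟩ hBt, Measure.real, ENNReal.ofReal_toReal (hfin B)]
      rfl
    · have : {y : t → ℝ | ∀ B : t, ENNReal.ofReal (y B) ∈ T B.1} =
          ⋂ B : t, (fun y => ENNReal.ofReal (y B)) ⁻¹' T B.1 := by ext; simp
      rw [this]
      exact MeasurableSet.iInter fun B =>
        (ENNReal.measurable_ofReal.comp (measurable_pi_apply B)) (hT B.1 B.2)
  rw [aux hP, aux hQ, map_measureReal_eq_of_charFunctional hP hQ h fun B : t => B.1.2]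

end CharacteristicFunctional

/-! ### Poisson laws on the space of measures and their semigroup property. -/

section PoissonLaw

variable {X : Type*} [MeasurableSpace X]

theorem measurable_integral_measure {f : X → ℝ} (hf : Measurable f) :
    Measurable fun v : Measure X => ∫ x, f x ∂v := by
  classical
  -- The Bochner integral defaults to 0 when f is not integrable, so the difference of positive and
  -- negative parts is valid only where ∫ |f| is finite.
  have h : (fun v : Measure X => ∫ x, f x ∂v) = fun v =>
      if ∫⁻ x, ‖f x‖ₑ ∂v < ∞ then
        (∫⁻ x, ENNReal.ofReal (f x) ∂v).toReal - (∫⁻ x, ENNReal.ofReal (-f x) ∂v).toReal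
      else 0 := by
    funext v
    split_ifs with hv
    · exact integral_eq_lintegral_pos_part_sub_lintegral_neg_part ⟨hf.aestronglyMeasurable, hv⟩
    · exact integral_undef fun hi => hv hi.2
  rw [h]
  refine Measurable.ite
    (measurableSet_lt (Measure.measurable_lintegral hf.enorm) measurable_const) ?_
    measurable_const
  exact (Measure.measurable_lintegral hf.ennreal_ofReal).ennreal_toReal.sub
    (Measure.measurable_lintegral hf.neg.ennreal_ofReal).ennreal_toReal

theorem measurable_cexp_integral_measure {f : X → ℝ} (hf : Measurable f) :
    Measurable fun v : Measure X => Complex.exp ((∫ x, f x ∂v : ℝ) * Complex.I) :=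
  Complex.measurable_exp.comp
    ((Complex.measurable_ofReal.comp (measurable_integral_measure hf)).mul_const _)

theorem integrable_cexp_integral_measure {P : Measure (Measure X)} [IsFiniteMeasure P]
    {f : X → ℝ} (hf : Measurable f) :
    Integrable (fun v : Measure X => Complex.exp ((∫ x, f x ∂v : ℝ) * Complex.I)) P :=
  Integrable.of_bound (measurable_cexp_integral_measure hf).aestronglyMeasurable 1
    (Filter.Eventually.of_forall fun _ => (Complex.norm_exp_ofReal_mul_I _).le)

theorem integrable_of_finite_range {f : X → ℝ} (hf : Measurable f) (hr : (Set.range f).Finite)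
    (v : Measure X) [IsFiniteMeasure v] : Integrable f v := by
  obtain ⟨C, hC⟩ := hr.isBounded.exists_norm_le
  exact Integrable.of_bound hf.aestronglyMeasurable C
    (Filter.Eventually.of_forall fun x => hC _ ⟨x, rfl⟩)

theorem measurable_sum_dirac (n : ℕ) :
    Measurable fun x : Fin n → X => ∑ i, Measure.dirac (x i) :=
  Finset.measurable_sum _ fun i _ => Measure.measurable_dirac.comp (measurable_pi_apply i)

/-- The image of `σ ^ n` under `(x_1, …, x_n) ↦ δ_{x_1} + ⋯ + δ_{x_n}`. -/
noncomputable def sumDiracLaw (σ : Measure X) (n : ℕ) : Measure (Measure X) :=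
  (Measure.pi fun _ : Fin n => σ).map fun x => ∑ i, Measure.dirac (x i)

/-- The law of the Poisson random measure with intensity `t σ`, as a mixture of binomial
processes. -/
noncomputable def poissonLaw (σ : Measure X) (t : ℝ) : Measure (Measure X) :=
  Measure.sum fun n : ℕ =>
    ENNReal.ofReal (Real.exp (-(t * σ.real Set.univ)) * (t ^ n / n.factorial)) • sumDiracLaw σ n

variable (σ : Measure X)

theorem lintegral_sumDiracLaw_zero {g : Measure X → ℝ≥0∞} (hg : Measurable g) :
    ∫⁻ v, g v ∂(sumDiracLaw σ 0) = g 0 := by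
  rw [sumDiracLaw, lintegral_map hg (measurable_sum_dirac 0)]
  simp

theorem ae_finite_poissonLaw (t : ℝ) : ∀ᵐ v ∂(poissonLaw σ t), v Set.univ < ∞ := by
  rw [poissonLaw, Measure.ae_sum_iff' (measurableSet_lt
    (Measure.measurable_coe MeasurableSet.univ) measurable_const)]
  refine fun n => Measure.ae_smul_measure ?_ _
  rw [sumDiracLaw, ae_map_iff (measurable_sum_dirac n).aemeasurable (measurableSet_lt
    (Measure.measurable_coe MeasurableSet.univ) measurable_const)]
  exact Filter.Eventually.of_forall fun x => measure_lt_top _ _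

theorem poissonLaw_zero : poissonLaw σ 0 = Measure.dirac 0 := by
  refine Measure.ext_of_lintegral _ fun g hg => ?_
  rw [poissonLaw, lintegral_sum_measure, tsum_eq_single 0 fun n hn => by simp [hn],
    lintegral_smul_measure, lintegral_sumDiracLaw_zero σ hg, lintegral_dirac' _ hg]
  simp

theorem lintegral_sumDiracLaw_one [SigmaFinite σ] {g : Measure X → ℝ≥0∞} (hg : Measurable g) :
    ∫⁻ v, g v ∂(sumDiracLaw σ 1) = ∫⁻ x, g (Measure.dirac x) ∂σ := by
  rw [sumDiracLaw, lintegral_map hg (measurable_sum_dirac 1)]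
  have h := measurePreserving_funUnique σ (Fin 1)
  refine Eq.trans ?_ (h.lintegral_comp (hg.comp Measure.measurable_dirac))
  simp [MeasurableEquiv.funUnique]
  rfl

variable [IsFiniteMeasure σ]

theorem sumDiracLaw_univ (n : ℕ) : sumDiracLaw σ n Set.univ = σ Set.univ ^ n := by
  rw [sumDiracLaw, Measure.map_apply (measurable_sum_dirac n) MeasurableSet.univ,
    Set.preimage_univ, Measure.pi_univ]
  simp

theorem integral_sumDiracLaw_cexp {f : X → ℝ} (hf : Measurable f) (n : ℕ) :
    ∫ v, Complex.exp ((∫ x, f x ∂v : ℝ) * Complex.I) ∂(sumDiracLaw σ n) =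
      (∫ x, Complex.exp (f x * Complex.I) ∂σ) ^ n := by
  rw [sumDiracLaw, integral_map (measurable_sum_dirac n).aemeasurable
    (measurable_cexp_integral_measure hf).aestronglyMeasurable]
  have h : ∀ x : Fin n → X, Complex.exp ((∫ y, f y ∂(∑ i, Measure.dirac (x i)) : ℝ) * Complex.I) =
      ∏ i, Complex.exp (f (x i) * Complex.I) := fun x => by
    rw [integral_finsetSum_measure fun i _ => integrable_dirac' hf.stronglyMeasurable (by simp)]
    simp_rw [integral_dirac' _ _ hf.stronglyMeasurable]
    rw [← Complex.exp_sum]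
    push_cast
    rw [Finset.sum_mul]
  simp_rw [h]
  rw [integral_fintype_prod_eq_prod (fun (_ : Fin n) x => Complex.exp (f x * Complex.I))]
  simp

theorem isProbabilityMeasure_poissonLaw {t : ℝ} (ht : 0 ≤ t) :
    IsProbabilityMeasure (poissonLaw σ t) := by
  constructor
  set s := σ.real Set.univ with hs
  have hs0 : 0 ≤ s := measureReal_nonneg
  have hterm : ∀ n : ℕ, (ENNReal.ofReal (Real.exp (-(t * s)) * (t ^ n / n.factorial)) •
      sumDiracLaw σ n) Set.univ =
      ENNReal.ofReal (Real.exp (-(t * s)) * ((t * s) ^ n / n.factorial)) := fun n => by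
    rw [Measure.smul_apply, sumDiracLaw_univ, smul_eq_mul, ← ofReal_measureReal (μ := σ),
      ← hs, ← ENNReal.ofReal_pow hs0, ← ENNReal.ofReal_mul (by positivity)]
    congr 1
    ring
  rw [poissonLaw, Measure.sum_apply _ MeasurableSet.univ]
  simp_rw [← hs, hterm]
  have hsum := (NormedSpace.expSeries_div_hasSum_exp (t * s)).mul_left (Real.exp (-(t * s)))
  rw [← ENNReal.ofReal_tsum_of_nonneg (fun n => by positivity) hsum.summable, hsum.tsum_eq,
    ← Real.exp_eq_exp_ℝ, ← Real.exp_add]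
  simp

theorem integral_poissonLaw_cexp {t : ℝ} (ht : 0 ≤ t) {f : X → ℝ} (hf : Measurable f) :
    ∫ v, Complex.exp ((∫ x, f x ∂v : ℝ) * Complex.I) ∂(poissonLaw σ t) =
      Complex.exp (t * (∫ x, Complex.exp (f x * Complex.I) ∂σ - σ.real Set.univ)) := by
  have := isProbabilityMeasure_poissonLaw σ ht
  have h := hasSum_integral_measure (integrable_cexp_integral_measure (P := poissonLaw σ t) hf)
  refine h.unique ?_
  have hterm : ∀ n : ℕ, ∫ v, Complex.exp ((∫ x, f x ∂v : ℝ) * Complex.I) ∂(ENNReal.ofReal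
      (Real.exp (-(t * σ.real Set.univ)) * (t ^ n / n.factorial)) • sumDiracLaw σ n) =
      Complex.exp (-(t * σ.real Set.univ)) *
        ((t * ∫ x, Complex.exp (f x * Complex.I) ∂σ) ^ n / n.factorial) := fun n => by
    rw [integral_smul_measure, integral_sumDiracLaw_cexp σ hf,
      ENNReal.toReal_ofReal (by positivity), Complex.real_smul]
    push_cast
    ring
  simp_rw [hterm]
  have hsum := (NormedSpace.expSeries_div_hasSum_exp
    (t * ∫ x, Complex.exp (f x * Complex.I) ∂σ : ℂ)).mul_left
      (Complex.exp (-(t * σ.real Set.univ)))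
  rw [← Complex.exp_eq_exp_ℂ, ← Complex.exp_add] at hsum
  rwa [mul_sub, sub_eq_neg_add]

/-- The logarithm of the characteristic functional is linear in the intensity parameter, so the
functionals multiply. -/
theorem poissonLaw_add {a b : ℝ} (ha : 0 ≤ a) (hb : 0 ≤ b) :
    poissonLaw σ (a + b) = poissonLaw σ a ∗ poissonLaw σ b := by
  have := isProbabilityMeasure_poissonLaw σ ha
  have := isProbabilityMeasure_poissonLaw σ hb
  have := isProbabilityMeasure_poissonLaw σ (add_nonneg ha hb)
  have hfin : ∀ᵐ v ∂(poissonLaw σ a ∗ poissonLaw σ b), v Set.univ < ∞ := by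
    rw [Measure.conv, ae_map_iff measurable_add.aemeasurable (measurableSet_lt
      (Measure.measurable_coe MeasurableSet.univ) measurable_const)]
    filter_upwards [Measure.quasiMeasurePreserving_fst.ae (ae_finite_poissonLaw σ a),
      Measure.quasiMeasurePreserving_snd.ae (ae_finite_poissonLaw σ b)] with p h1 h2
    simpa using ⟨h1, h2⟩
  refine ext_of_charFunctional (ae_finite_poissonLaw σ _) hfin fun f hf hr => ?_
  rw [integral_conv (integrable_cexp_integral_measure hf),
    integral_poissonLaw_cexp σ (add_nonneg ha hb) hf]
  have h : ∀ᵐ v ∂(poissonLaw σ a), ∫ w, Complex.exp ((∫ x, f x ∂(v + w) : ℝ) * Complex.I)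
      ∂(poissonLaw σ b) = Complex.exp ((∫ x, f x ∂v : ℝ) * Complex.I) *
        ∫ w, Complex.exp ((∫ x, f x ∂w : ℝ) * Complex.I) ∂(poissonLaw σ b) := by
    filter_upwards [ae_finite_poissonLaw σ a] with v hv
    rw [← integral_const_mul]
    refine integral_congr_ae ?_
    filter_upwards [ae_finite_poissonLaw σ b] with w hw
    have : IsFiniteMeasure v := ⟨hv⟩
    have : IsFiniteMeasure w := ⟨hw⟩
    rw [integral_add_measure (integrable_of_finite_range hf hr v)
      (integrable_of_finite_range hf hr w), ← Complex.exp_add]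
    push_cast
    ring_nf
  rw [integral_congr_ae h, integral_mul_const, integral_poissonLaw_cexp σ ha hf,
    integral_poissonLaw_cexp σ hb hf, ← Complex.exp_add]
  push_cast
  congr 1
  ring

end PoissonLaw

/-! ### Poincaré inequality by infinitesimal splitting. -/

section PoincareInequality

variable {X : Type*} [MeasurableSpace X] (σ : Measure X)

/-- The n-th weights have ratio aⁿ e^{(1−a)σ(X)}, and aⁿ ≤ 1. This replaces the base law of
intensity 1 − h by that of intensity 1, at a cost tending to 1. -/
theorem poissonLaw_le {a : ℝ} (ha : 0 ≤ a) (ha1 : a ≤ 1) :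
    poissonLaw σ a ≤
      ENNReal.ofReal (Real.exp ((1 - a) * σ.real Set.univ)) • poissonLaw σ 1 := by
  set s := σ.real Set.univ with hs
  refine Measure.le_iff.2 fun A hA => ?_
  rw [Measure.smul_apply, poissonLaw, poissonLaw, Measure.sum_apply _ hA, Measure.sum_apply _ hA,
    smul_eq_mul, ← ENNReal.tsum_mul_left]
  refine ENNReal.tsum_le_tsum fun n => ?_
  rw [Measure.smul_apply, Measure.smul_apply, smul_eq_mul, smul_eq_mul, ← mul_assoc,
    ← ENNReal.ofReal_mul (by positivity), ← mul_assoc, ← Real.exp_add, ← hs]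
  gcongr
  linarith

variable [IsFiniteMeasure σ]

/-- First-order expansion in the intensity: no atom contributes g 0 = 0, one atom gives the linear
term, and n ≥ 2 atoms carry hⁿ ≤ h², with the weights σ(X)ⁿ/n! summing to at most e^{σ(X)}. -/
theorem lintegral_poissonLaw_le {g : Measure X → ℝ≥0∞} (hg : Measurable g) (hg0 : g 0 = 0)
    {D : ℝ≥0∞} (hD : ∀ v, g v ≤ D) {h : ℝ} (hh : 0 ≤ h) (hh1 : h ≤ 1) :
    ∫⁻ v, g v ∂(poissonLaw σ h) ≤ ENNReal.ofReal h * ∫⁻ x, g (Measure.dirac x) ∂σ +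
      ENNReal.ofReal (h ^ 2) * (D * ENNReal.ofReal (Real.exp (σ.real Set.univ))) := by
  set s := σ.real Set.univ with hs
  have hs0 : 0 ≤ s := measureReal_nonneg
  have hexp : Real.exp (-(h * s)) ≤ 1 := Real.exp_le_one_iff.2 (by nlinarith)
  have hterm : ∀ n : ℕ, ∫⁻ v, g v ∂(ENNReal.ofReal (Real.exp (-(h * s)) * (h ^ n / n.factorial)) •
      sumDiracLaw σ n) ≤ (if n = 1 then ENNReal.ofReal h * ∫⁻ x, g (Measure.dirac x) ∂σ else 0) +
        ENNReal.ofReal (h ^ 2) * (D * ENNReal.ofReal (s ^ n / n.factorial)) := by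
    intro n
    rw [lintegral_smul_measure, smul_eq_mul]
    match n with
    | 0 => simp [lintegral_sumDiracLaw_zero σ hg, hg0]
    | 1 =>
      rw [lintegral_sumDiracLaw_one σ hg, if_pos rfl]
      refine le_add_of_le_of_nonneg ?_ zero_le
      gcongr
      simpa using mul_le_of_le_one_left hh hexp
    | n + 2 =>
      rw [if_neg (by omega), zero_add]
      have h1 : ∫⁻ v, g v ∂(sumDiracLaw σ (n + 2)) ≤ D * ENNReal.ofReal (s ^ (n + 2)) := by
        refine (lintegral_mono hD).trans ?_
        rw [lintegral_const, sumDiracLaw_univ, ENNReal.ofReal_pow hs0, hs, ofReal_measureReal]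
      have h2 : Real.exp (-(h * s)) * (h ^ (n + 2) / (n + 2).factorial) ≤
          h ^ 2 * (1 / (n + 2).factorial) := by
        rw [mul_one_div]
        refine (mul_le_of_le_one_left (by positivity) hexp).trans ?_
        exact div_le_div_of_nonneg_right (pow_le_pow_of_le_one hh hh1 (by omega)) (by positivity)
      refine (mul_le_mul' (ENNReal.ofReal_le_ofReal h2) h1).trans_eq ?_
      rw [ENNReal.ofReal_mul (by positivity), div_eq_mul_one_div (s ^ (n + 2)),
        ENNReal.ofReal_mul (by positivity)]
      ring
  rw [poissonLaw, lintegral_sum_measure]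
  refine (ENNReal.tsum_le_tsum hterm).trans_eq ?_
  have hsum := NormedSpace.expSeries_div_hasSum_exp s
  rw [ENNReal.tsum_add, tsum_ite_eq, ENNReal.tsum_mul_left, ENNReal.tsum_mul_left,
    ← ENNReal.ofReal_tsum_of_nonneg (fun n => by positivity) hsum.summable, hsum.tsum_eq,
    ← Real.exp_eq_exp_ℝ]

theorem measurable_increment {G : Measure X → ℝ} (hG : Measurable G) :
    Measurable fun p : Measure X × Measure X => ENNReal.ofReal ((G (p.1 + p.2) - G p.1) ^ 2) :=
  (((hG.comp (measurable_fst.add measurable_snd)).sub (hG.comp measurable_fst)).pow_const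
    2).ennreal_ofReal

theorem measurable_jump {G : Measure X → ℝ} (hG : Measurable G) :
    Measurable fun v : Measure X =>
      ∫⁻ x, ENNReal.ofReal ((G (v + Measure.dirac x) - G v) ^ 2) ∂σ := by
  have h1 : Measurable fun p : Measure X × X => G (p.1 + Measure.dirac p.2) :=
    hG.comp (measurable_fst.add (Measure.measurable_dirac.comp measurable_snd))
  have h2 : Measurable fun p : Measure X × X => G p.1 := hG.comp measurable_fst
  exact ((h1.sub h2).pow_const 2).ennreal_ofReal.lintegral_prod_right'

theorem abs_increment_sq_le {G : Measure X → ℝ} {C : ℝ} (hC : ∀ v, |G v| ≤ C)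
    (v w : Measure X) : |(G (v + w) - G v) ^ 2| ≤ (2 * C) ^ 2 :=
  abs_sq_le_of_abs_le ((abs_sub _ _).trans (by linarith [hC (v + w), hC v]))

theorem ofReal_integral_increment {P Q : Measure (Measure X)} [IsProbabilityMeasure P]
    [IsProbabilityMeasure Q] {G : Measure X → ℝ} (hG : Measurable G) {C : ℝ}
    (hC : ∀ v, |G v| ≤ C) :
    ENNReal.ofReal (∫ v, ∫ w, (G (v + w) - G v) ^ 2 ∂Q ∂P) =
      ∫⁻ v, ∫⁻ w, ENNReal.ofReal ((G (v + w) - G v) ^ 2) ∂Q ∂P := by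
  have hm1 : Measurable fun p : Measure X × Measure X => (G (p.1 + p.2) - G p.1) ^ 2 :=
    ((hG.comp (measurable_fst.add measurable_snd)).sub (hG.comp measurable_fst)).pow_const 2
  rw [ofReal_integral_eq_lintegral_ofReal (integrable_of_measurable_of_abs_le
    (hm1.stronglyMeasurable.integral_prod_right').measurable
      fun v => abs_integral_le_of_abs_le (abs_increment_sq_le hC v))
    (Filter.Eventually.of_forall fun v => integral_nonneg fun w => sq_nonneg _)]
  refine lintegral_congr fun v => ?_
  exact ofReal_integral_eq_lintegral_ofReal (integrable_of_measurable_of_abs_le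
    (hm1.comp measurable_prodMk_left) (abs_increment_sq_le hC v))
    (Filter.Eventually.of_forall fun w => sq_nonneg _)

theorem mul_lintegral_increment_le {G : Measure X → ℝ} (hG : Measurable G) {C : ℝ}
    (hC : ∀ v, |G v| ≤ C) {j h : ℝ} (hj : 0 ≤ j) (h0 : 0 ≤ h) (h1 : h ≤ 1) (hjh : j * h = 1)
    (v : Measure X) :
    ENNReal.ofReal j * ∫⁻ w, ENNReal.ofReal ((G (v + w) - G v) ^ 2) ∂(poissonLaw σ h) ≤
      ∫⁻ x, ENNReal.ofReal ((G (v + Measure.dirac x) - G v) ^ 2) ∂σ + ENNReal.ofReal h *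
        (ENNReal.ofReal ((2 * C) ^ 2) * ENNReal.ofReal (Real.exp (σ.real Set.univ))) := by
  have := lintegral_poissonLaw_le σ (g := fun w => ENNReal.ofReal ((G (v + w) - G v) ^ 2))
    ((measurable_increment hG).comp measurable_prodMk_left) (by simp)
    (fun w => ENNReal.ofReal_le_ofReal ((le_abs_self _).trans (abs_increment_sq_le hC v w))) h0 h1
  refine (mul_le_mul_right this _).trans_eq ?_
  rw [mul_add, ← mul_assoc, ← mul_assoc, ← ENNReal.ofReal_mul hj,
    ← ENNReal.ofReal_mul hj, sq, ← mul_assoc j, hjh]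
  simp

theorem integral_sq_sub_sq_integral_poissonLaw_le {G : Measure X → ℝ} (hG : Measurable G) {C : ℝ}
    (hC : ∀ v, |G v| ≤ C) (j : ℕ) {h : ℝ} (h0 : 0 ≤ h) (hjh : ((j : ℝ) + 1) * h = 1) :
    ∫ v, G v ^ 2 ∂(poissonLaw σ 1) - (∫ v, G v ∂(poissonLaw σ 1)) ^ 2 ≤
      ((j : ℝ) + 1) * ∫ v, ∫ w, (G (v + w) - G v) ^ 2 ∂(poissonLaw σ h)
        ∂(poissonLaw σ (j * h)) := by
  have : ∀ i : ℕ, IsProbabilityMeasure (poissonLaw σ (i * h)) := fun i =>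
    isProbabilityMeasure_poissonLaw σ (by positivity)
  have hjh' : ((j + 1 : ℕ) : ℝ) * h = 1 := by exact_mod_cast hjh
  have key := variance_conv_pow_le (P := fun i : ℕ => poissonLaw σ (i * h))
    (by simpa using poissonLaw_zero σ)
    (fun i => by
      rw [← poissonLaw_add σ (by positivity) (by positivity)]
      congr 1; push_cast; ring) j hG hC
  simpa only [hjh', Nat.cast_one, one_mul] using key

/-- The variance bound obtained by splitting the Poisson random measure into `j + 1` independent
pieces. -/
theorem variance_poissonLaw_le_aux {G : Measure X → ℝ} (hG : Measurable G) {C : ℝ}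
    (hC : ∀ v, |G v| ≤ C) (j : ℕ) {h : ℝ} (h0 : 0 ≤ h) (h1 : h ≤ 1)
    (hjh : ((j : ℝ) + 1) * h = 1) :
    ENNReal.ofReal (∫ v, G v ^ 2 ∂(poissonLaw σ 1) - (∫ v, G v ∂(poissonLaw σ 1)) ^ 2) ≤
      ENNReal.ofReal (Real.exp (h * σ.real Set.univ)) *
        ∫⁻ v, ∫⁻ x, ENNReal.ofReal ((G (v + Measure.dirac x) - G v) ^ 2) ∂σ ∂(poissonLaw σ 1) +
      ENNReal.ofReal h *
        (ENNReal.ofReal ((2 * C) ^ 2) * ENNReal.ofReal (Real.exp (σ.real Set.univ))) := by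
  have hP1 : IsProbabilityMeasure (poissonLaw σ h) := isProbabilityMeasure_poissonLaw σ h0
  have hPj : IsProbabilityMeasure (poissonLaw σ (j * h)) :=
    isProbabilityMeasure_poissonLaw σ (by positivity)
  refine (ENNReal.ofReal_le_ofReal
    (integral_sq_sub_sq_integral_poissonLaw_le σ hG hC j h0 hjh)).trans ?_
  rw [ENNReal.ofReal_mul (by positivity), ofReal_integral_increment hG hC,
    ← lintegral_const_mul' _ _ ENNReal.ofReal_ne_top]
  refine (lintegral_mono (mul_lintegral_increment_le σ hG hC (by positivity) h0 h1 hjh)).trans ?_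
  rw [lintegral_add_left (measurable_jump σ hG), lintegral_const, measure_univ, mul_one]
  refine add_le_add_left ?_ _
  have hj1 : 1 - j * h = h := by linarith
  have := poissonLaw_le σ (a := j * h) (by positivity) (by linarith)
  rw [hj1] at this
  refine (lintegral_mono' this le_rfl).trans_eq ?_
  rw [lintegral_smul_measure, smul_eq_mul]

/-- The Poincaré inequality for bounded functions of a Poisson random measure. -/
theorem variance_poissonLaw_le_of_bounded {G : Measure X → ℝ} (hG : Measurable G) {C : ℝ}
    (hC : ∀ v, |G v| ≤ C) :
    ENNReal.ofReal (∫ v, G v ^ 2 ∂(poissonLaw σ 1) - (∫ v, G v ∂(poissonLaw σ 1)) ^ 2) ≤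
      ∫⁻ v, ∫⁻ x, ENNReal.ofReal ((G (v + Measure.dirac x) - G v) ^ 2) ∂σ
        ∂(poissonLaw σ 1) := by
  have ht := tendsto_one_div_add_atTop_nhds_zero_nat (𝕜 := ℝ)
  have h1 : Filter.Tendsto
      (fun j : ℕ => ENNReal.ofReal (Real.exp (1 / ((j : ℝ) + 1) * σ.real Set.univ)))
      Filter.atTop (nhds 1) := by
    have := ENNReal.tendsto_ofReal
      ((Real.continuous_exp.tendsto _).comp (ht.mul_const (σ.real Set.univ)))
    simpa using this
  have h2 : Filter.Tendsto (fun j : ℕ => ENNReal.ofReal (1 / ((j : ℝ) + 1)))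
      Filter.atTop (nhds 0) := by
    simpa using ENNReal.tendsto_ofReal ht
  -- The energy may be infinite. Its prefactor tends to 1 ≠ 0, so the limit of the product is still
  -- valid.
  have h3 := (ENNReal.Tendsto.mul_const (b := ∫⁻ v, ∫⁻ x,
      ENNReal.ofReal ((G (v + Measure.dirac x) - G v) ^ 2) ∂σ ∂(poissonLaw σ 1)) h1
      (Or.inl one_ne_zero)).add (ENNReal.Tendsto.mul_const
        (b := ENNReal.ofReal ((2 * C) ^ 2) * ENNReal.ofReal (Real.exp (σ.real Set.univ))) h2
        (Or.inr (ENNReal.mul_ne_top ENNReal.ofReal_ne_top ENNReal.ofReal_ne_top)))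
  rw [one_mul, zero_mul, add_zero] at h3
  exact ge_of_tendsto' h3 fun j =>
    variance_poissonLaw_le_aux σ hG hC j (by positivity)
      (by rw [div_le_one (by positivity)]; linarith [j.cast_nonneg (α := ℝ)]) (by field_simp)

/-- The Poincaré inequality for square-integrable functions of a Poisson random measure. -/
theorem evariance_poissonLaw_le {G : Measure X → ℝ} (hG : Measurable G)
    (hG2 : MemLp G 2 (poissonLaw σ 1)) :
    evariance G (poissonLaw σ 1) ≤
      ∫⁻ v, ∫⁻ x, ENNReal.ofReal ((G (v + Measure.dirac x) - G v) ^ 2) ∂σ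
        ∂(poissonLaw σ 1) := by
  have := isProbabilityMeasure_poissonLaw σ zero_le_one
  -- Truncation at ±n is 1-Lipschitz, so it does not enlarge jumps; dominated convergence recovers
  -- the variance.
  let T : ℕ → ℝ → ℝ := fun n y => max (min y n) (-(n : ℝ))
  have hTm : ∀ n, Measurable fun v => T n (G v) := fun n =>
    (hG.min measurable_const).max measurable_const
  have hTb : ∀ n y, |T n y| ≤ n := fun n y => abs_le.2
    ⟨le_max_right _ _, max_le (min_le_right _ _) (by linarith [n.cast_nonneg (α := ℝ)])⟩
  have hTy : ∀ n y, |T n y| ≤ |y| := fun n y => by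
    have hn := n.cast_nonneg (α := ℝ)
    refine abs_le.2 ⟨?_, max_le ((min_le_left _ _).trans (le_abs_self y))
      (by linarith [abs_nonneg y])⟩
    exact le_max_of_le_left (le_min (neg_abs_le y) (by linarith [abs_nonneg y]))
  have hTl : ∀ n y z, |T n y - T n z| ≤ |y - z| := fun n y z =>
    (abs_max_sub_max_le_abs _ _ _).trans (by
      simpa using abs_min_sub_min_le_max y n z n)
  have hTt : ∀ y, Filter.Tendsto (fun n => T n y) Filter.atTop (nhds y) := fun y => by
    refine tendsto_const_nhds.congr' ?_
    obtain ⟨N, hN⟩ := exists_nat_ge |y|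
    filter_upwards [Filter.eventually_ge_atTop N] with n hn
    have : |y| ≤ n := hN.trans (by exact_mod_cast hn)
    simp only [T]
    rw [min_eq_left ((le_abs_self y).trans this),
      max_eq_left (by linarith [neg_abs_le y])]
  have i1 : Integrable G (poissonLaw σ 1) := hG2.integrable one_le_two
  have t1 : Filter.Tendsto (fun n => ∫ v, T n (G v) ∂(poissonLaw σ 1)) Filter.atTop
      (nhds (∫ v, G v ∂(poissonLaw σ 1))) :=
    tendsto_integral_of_dominated_convergence (fun v => |G v|)
      (fun n => (hTm n).aestronglyMeasurable) i1.abs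
      (fun n => Filter.Eventually.of_forall fun v => hTy n _)
      (Filter.Eventually.of_forall fun v => hTt _)
  have t2 : Filter.Tendsto (fun n => ∫ v, T n (G v) ^ 2 ∂(poissonLaw σ 1)) Filter.atTop
      (nhds (∫ v, G v ^ 2 ∂(poissonLaw σ 1))) :=
    tendsto_integral_of_dominated_convergence (fun v => G v ^ 2)
      (fun n => ((hTm n).pow_const 2).aestronglyMeasurable) hG2.integrable_sq
      (fun n => Filter.Eventually.of_forall fun v => by
        rw [Real.norm_eq_abs, abs_pow, ← sq_abs (G v)]
        exact pow_le_pow_left₀ (abs_nonneg _) (hTy n _) 2)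
      (Filter.Eventually.of_forall fun v => (hTt _).pow 2)
  rw [← hG2.ofReal_variance_eq, variance_eq_sub hG2]
  refine le_of_tendsto' (ENNReal.tendsto_ofReal (t2.sub (t1.pow 2))) fun n => ?_
  refine (variance_poissonLaw_le_of_bounded σ (hTm n) fun v => hTb n _).trans ?_
  refine lintegral_mono fun v => lintegral_mono fun x => ENNReal.ofReal_le_ofReal ?_
  exact sq_le_sq.2 (hTl n _ _)

end PoincareInequality

/-! ### From configurations to random measures. -/

theorem integral_comp_of_finite_range {X E ι : Type*} [MeasurableSpace X] [Fintype ι]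
    [NormedAddCommGroup E] [NormedSpace ℝ E] [CompleteSpace E] {f : X → ℝ} (hf : Measurable f)
    {c : ι → ℝ} (hc : Function.Injective c) (hfc : ∀ x, f x ∈ Set.range c) (g : ℝ → E)
    (v : Measure X) [IsFiniteMeasure v] :
    ∫ x, g (f x) ∂v = ∑ i, v.real (f ⁻¹' {c i}) • g (c i) := by
  classical
  have hm : ∀ i, MeasurableSet (f ⁻¹' {c i}) := fun i => hf (measurableSet_singleton _)
  have h : ∀ x, g (f x) = ∑ i, (f ⁻¹' {c i}).indicator (fun _ => g (c i)) x := fun x => by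
    obtain ⟨i, hi⟩ := hfc x
    rw [Finset.sum_eq_single i]
    · simp [← hi]
    · intro k _ hk
      exact Set.indicator_of_notMem (fun hx : f x = c k => hk (hc (hx.symm.trans hi.symm))) _
    · simp
  simp_rw [h]
  rw [integral_finsetSum _ fun i _ => (integrable_const _).indicator (hm i)]
  exact Finset.sum_congr rfl fun i _ => integral_indicator_const _ (hm i)

theorem ofReal_prod_poisson_eq {X ι : Type*} [MeasurableSpace X] [Fintype ι]
    (σ : Measure X) (A : ι → Set X) (k : ι → ℕ) :
    ENNReal.ofReal
      (∏ i, σ.real (A i) ^ k i / (k i).factorial * Real.exp (-σ.real (A i))) =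
      ∏ i, poissonMeasure (σ (A i)).toNNReal {k i} := by
  rw [ENNReal.ofReal_prod_of_nonneg fun i _ => by positivity]
  refine Finset.prod_congr rfl fun i _ => ?_
  rw [poissonMeasure_singleton]
  congr 1
  change _ = Real.exp (-σ.real (A i)) * σ.real (A i) ^ k i / _
  ring

namespace Configuration

theorem number_ne_top {X : Type*} [TopologicalSpace X] {ω : Configuration X}
    (h : ω.number Set.univ ≠ ⊤) (B : Set X) :
    ω.number B ≠ ⊤ :=
  ((Set.encard_le_encard (Set.inter_subset_inter_right _ (Set.subset_univ B))).trans_lt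
    h.lt_top).ne

variable {X : Type*} [TopologicalSpace X] [MeasurableSpace X]

theorem toMeasure_apply (ω : Configuration X) {B : Set X} (hB : MeasurableSet B) :
    ω.toMeasure B = (ω.number B : ℝ≥0∞) := by
  rw [toMeasure, Measure.sum_apply _ hB, number, ← ENNReal.tsum_set_one]
  simp_rw [Measure.dirac_apply' _ hB]
  rw [tsum_subtype ω.carrier (B.indicator 1), tsum_subtype (ω.carrier ∩ B) (fun _ => (1 : ℝ≥0∞)),
    Set.indicator_indicator]
  rfl

theorem measurable_number {B : Set X} (hB : MeasurableSet B) :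
    Measurable[_, ⊤] fun ω : Configuration X => ω.number B := by
  refine Measurable.mono (comap_measurable _) ?_ le_rfl
  exact le_iSup₂ (f := fun (B : Set X) (_ : MeasurableSet B) =>
    MeasurableSpace.comap (fun ω : Configuration X => number ω B) ⊤) B hB

theorem measurable_toMeasure : Measurable (toMeasure : Configuration X → Measure X) := by
  refine Measure.measurable_of_measurable_coe _ fun B hB => ?_
  simp_rw [toMeasure_apply _ hB]
  exact (measurable_from_top (f := fun k : ℕ∞ => (k : ℝ≥0∞))).comp (measurable_number hB)

theorem measurableSpace_le_comap_toMeasure :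
    (instMeasurableSpace : MeasurableSpace (Configuration X)) ≤
      MeasurableSpace.comap toMeasure inferInstance := by
  refine iSup₂_le fun B hB => ?_
  rintro _ ⟨S, -, rfl⟩
  refine ⟨(fun v : Measure X => v B) ⁻¹' ((fun k : ℕ∞ => (k : ℝ≥0∞)) '' S), ?_, ?_⟩
  -- Any subset of `ℕ∞` is countable, hence its image in `ℝ≥0∞` is Borel.
  · exact Measure.measurable_coe hB (S.to_countable.image _).measurableSet
  · ext ω
    simp only [Set.mem_preimage, toMeasure_apply _ hB]
    exact ⟨fun ⟨k, hk, hk'⟩ => by rwa [← ENat.toENNReal_inj.1 hk'], fun h => ⟨_, h, rfl⟩⟩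

/-- Every measurable function of the configuration is a measurable function of the associated
counting measure. -/
theorem exists_eq_comp_toMeasure {F : Configuration X → ℝ} (hF : Measurable F) :
    ∃ G : Measure X → ℝ, Measurable G ∧ F = G ∘ toMeasure :=
  (hF.mono measurableSpace_le_comap_toMeasure le_rfl).exists_eq_measurable_comp

variable {σ : Measure X} {π : Measure (Configuration X)}

theorem IsPoissonMeasure.isProbabilityMeasure (hπ : IsPoissonMeasure σ π) :
    IsProbabilityMeasure π :=
  ⟨by simpa using hπ 0 Fin.elim0 (fun i => i.elim0) (fun i => i.elim0) Fin.elim0⟩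

/-- The definition prescribes only the probabilities of finite counts; these already sum to 1. -/
theorem IsPoissonMeasure.ae_number_univ_ne_top (hπ : IsPoissonMeasure σ π) :
    ∀ᵐ ω ∂π, ω.number Set.univ ≠ ⊤ := by
  have := hπ.isProbabilityMeasure
  have hms : ∀ k : ℕ, MeasurableSet {ω : Configuration X | ω.number Set.univ = k} := fun k =>
    measurable_number MeasurableSet.univ (t := {(k : ℕ∞)}) trivial
  have hone : ∀ k : ℕ, π {ω | ω.number Set.univ = k} =
      poissonMeasure (σ Set.univ).toNNReal {k} := fun k => by
    have := hπ 1 (fun _ => Set.univ) (fun _ => MeasurableSet.univ)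
      (fun i j hij => absurd (Subsingleton.elim i j) hij) (fun _ => k)
    rw [ofReal_prod_poisson_eq] at this
    simpa using this
  have hU : {ω : Configuration X | ω.number Set.univ ≠ ⊤} =
      ⋃ k : ℕ, {ω | ω.number Set.univ = (k : ℕ∞)} := by
    ext ω
    rw [Set.mem_iUnion]
    exact ENat.ne_top_iff_exists.trans ⟨fun ⟨k, hk⟩ => ⟨k, hk.symm⟩, fun ⟨k, hk⟩ => ⟨k, hk.symm⟩⟩
  have hUm : MeasurableSet {ω : Configuration X | ω.number Set.univ ≠ ⊤} := by
    rw [hU]; exact MeasurableSet.iUnion hms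
  refine mem_ae_iff.2 ((prob_compl_eq_zero_iff hUm).2 ?_)
  rw [hU, measure_iUnion _ hms]
  · simp_rw [hone]
    rw [← measure_iUnion (fun i j hij => by simpa using hij) fun k => measurableSet_singleton k,
      Set.iUnion_of_singleton, measure_univ]
  · intro i j hij
    refine Set.disjoint_left.2 fun ω (hi : ω.number Set.univ = i)
      (hj : ω.number Set.univ = j) => hij ?_
    exact_mod_cast hi.symm.trans hj

theorem toMeasure_univ_lt_top {ω : Configuration X} (h : ω.number Set.univ ≠ ⊤) :
    ω.toMeasure Set.univ < ∞ := by
  rw [toMeasure_apply _ MeasurableSet.univ]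
  exact ENat.toENNReal_lt_top.2 h.lt_top

theorem toMeasure_real (ω : Configuration X) {B : Set X} (hB : MeasurableSet B) :
    ω.toMeasure.real B = ((ω.number B).toNat : ℝ) := by
  rw [Measure.real, toMeasure_apply _ hB]
  cases ω.number B <;> simp

theorem measurable_toNat_number {B : Set X} (hB : MeasurableSet B) :
    Measurable fun ω : Configuration X => (ω.number B).toNat :=
  (measurable_from_top (f := ENat.toNat)).comp (measurable_number hB)

/-- The numbers of points in disjoint sets are independent Poisson variables. -/
theorem IsPoissonMeasure.map_toNat_number (hπ : IsPoissonMeasure σ π) {n : ℕ}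
    {A : Fin n → Set X} (hA : ∀ i, MeasurableSet (A i))
    (hd : Pairwise fun i j => Disjoint (A i) (A j)) :
    π.map (fun ω i => (ω.number (A i)).toNat) =
      Measure.pi fun i => poissonMeasure (σ (A i)).toNNReal := by
  refine Measure.ext_of_singleton fun k => ?_
  rw [Measure.map_apply (measurable_pi_lambda _ fun i => measurable_toNat_number (hA i))
    (measurableSet_singleton k), Measure.pi_singleton, ← ofReal_prod_poisson_eq, ← hπ n A hA hd k]
  refine measure_congr (hπ.ae_number_univ_ne_top.mono fun ω hω => propext ?_)
  change (fun i => (ω.number (A i)).toNat) = k ↔ ∀ i, ω.number (A i) = k i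
  rw [funext_iff]
  refine forall_congr' fun i => ?_
  rw [← ENat.natCast_toNat (number_ne_top hω (A i))]
  simp

theorem IsPoissonMeasure.map_toNat_number_univ (hπ : IsPoissonMeasure σ π) :
    π.map (fun ω => (ω.number Set.univ).toNat) = poissonMeasure (σ Set.univ).toNNReal := by
  have h := hπ.map_toNat_number (n := 1) (A := fun _ => Set.univ) (fun _ => MeasurableSet.univ)
    (fun i j hij => absurd (Subsingleton.elim i j) hij)
  have h2 := congrArg (Measure.map fun y : Fin 1 → ℕ => y 0) h
  rw [Measure.map_map (measurable_pi_apply 0) (measurable_pi_lambda _ fun i =>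
    measurable_toNat_number MeasurableSet.univ)] at h2
  refine Eq.trans h2 ?_
  exact (measurePreserving_eval (fun _ : Fin 1 => poissonMeasure (σ Set.univ).toNNReal) 0).map_eq

/-- The level sets of f partition X, so ∫ f dω is a linear combination of independent Poisson counts
and the Poisson characteristic functions multiply. -/
theorem IsPoissonMeasure.integral_cexp (hπ : IsPoissonMeasure σ π) [IsFiniteMeasure σ]
    {f : X → ℝ} (hf : Measurable f) (hr : (Set.range f).Finite) :
    ∫ ω, Complex.exp ((∫ x, f x ∂ω.toMeasure : ℝ) * Complex.I) ∂π =
      Complex.exp (∫ x, Complex.exp (f x * Complex.I) ∂σ - σ.real Set.univ) := by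
  have := hπ.isProbabilityMeasure
  have : Fintype (Set.range f) := hr.fintype
  let e := Fintype.equivFin (Set.range f)
  let c : Fin (Fintype.card (Set.range f)) → ℝ := fun i => (e.symm i : ℝ)
  have hc : Function.Injective c := Subtype.val_injective.comp e.symm.injective
  have hfc : ∀ x, f x ∈ Set.range c := fun x => ⟨e ⟨f x, x, rfl⟩, by simp [c]⟩
  have hA : ∀ i, MeasurableSet (f ⁻¹' {c i}) := fun i => hf (measurableSet_singleton _)
  have hd : Pairwise fun i j => Disjoint (f ⁻¹' {c i}) (f ⁻¹' {c j}) := fun i j hij =>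
    Disjoint.preimage f (Set.disjoint_singleton.2 fun h => hij (hc h))
  have h1 : ∫ ω, Complex.exp ((∫ x, f x ∂ω.toMeasure : ℝ) * Complex.I) ∂π =
      ∫ y, ∏ i, Complex.exp (c i * (y i : ℝ) * Complex.I)
        ∂(π.map (fun ω i => (ω.number (f ⁻¹' {c i})).toNat)) := by
    rw [integral_map (measurable_pi_lambda _ fun i => measurable_toNat_number (hA i)).aemeasurable
      Measurable.of_discrete.aestronglyMeasurable]
    refine integral_congr_ae (hπ.ae_number_univ_ne_top.mono fun ω hω => ?_)
    have : IsFiniteMeasure ω.toMeasure := ⟨toMeasure_univ_lt_top hω⟩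
    simp only
    rw [integral_comp_of_finite_range hf hc hfc (fun y => y), ← Complex.exp_sum, ← Finset.sum_mul]
    simp_rw [toMeasure_real ω (hA _), smul_eq_mul, mul_comm _ (c _)]
    push_cast
    rfl
  rw [h1, hπ.map_toNat_number hA hd, integral_fintype_prod_eq_prod
    (fun i (y : ℕ) => Complex.exp (c i * (y : ℝ) * Complex.I))]
  have h2 : ∀ i, ∫ y : ℕ, Complex.exp (c i * (y : ℝ) * Complex.I)
      ∂(poissonMeasure (σ (f ⁻¹' {c i})).toNNReal) =
      Complex.exp (σ.real (f ⁻¹' {c i}) * (Complex.exp (c i * Complex.I) - 1)) := fun i => by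
    have := charFun_map_cast_poissonMeasure (σ (f ⁻¹' {c i})).toNNReal (c i)
    rw [charFun_apply_real, integral_map .of_discrete (by fun_prop)] at this
    exact this
  simp_rw [h2]
  rw [← Complex.exp_sum, integral_comp_of_finite_range hf hc hfc
    (fun y => Complex.exp (y * Complex.I))]
  have h3 := integral_comp_of_finite_range hf hc hfc (fun _ => (1 : ℝ)) σ
  simp only [integral_const, smul_eq_mul, mul_one] at h3
  rw [h3]
  push_cast
  rw [← Finset.sum_sub_distrib]
  simp [mul_sub]

/-- The Poisson measure is the mixture of binomial processes. -/
theorem IsPoissonMeasure.map_toMeasure (hπ : IsPoissonMeasure σ π) [IsFiniteMeasure σ] :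
    π.map toMeasure = poissonLaw σ 1 := by
  have := hπ.isProbabilityMeasure
  have := isProbabilityMeasure_poissonLaw σ zero_le_one
  have : IsProbabilityMeasure (π.map toMeasure) :=
    Measure.isProbabilityMeasure_map measurable_toMeasure.aemeasurable
  refine ext_of_charFunctional ?_ (ae_finite_poissonLaw σ 1) fun f hf hr => ?_
  · rw [ae_map_iff measurable_toMeasure.aemeasurable (measurableSet_lt
      (Measure.measurable_coe MeasurableSet.univ) measurable_const)]
    exact hπ.ae_number_univ_ne_top.mono fun ω hω => toMeasure_univ_lt_top hω
  · rw [integral_map measurable_toMeasure.aemeasurable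
      (measurable_cexp_integral_measure hf).aestronglyMeasurable, hπ.integral_cexp hf hr,
      integral_poissonLaw_cexp σ zero_le_one hf]
    simp

end Configuration

/-! ### Mean and variance of the Poisson distribution. -/

section PoissonMoments

open scoped NNReal Nat

/-- Stein–Chen identity E[N g(N)] = r E[g(N+1)], by an index shift; g = 1 and g = n give the first
two moments. -/
theorem hasSum_poisson_mul (r : ℝ≥0) {g : ℕ → ℝ} {S : ℝ}
    (h : HasSum (fun n : ℕ => Real.exp (-r) * r ^ n / n ! * g (n + 1)) S) :
    HasSum (fun n : ℕ => Real.exp (-r) * r ^ n / n ! * (n * g n)) (r * S) := by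
  refine (hasSum_nat_add_iff' 1).1 ?_
  convert! h.mul_left (r : ℝ) using 1
  · funext n
    have := n.factorial_pos
    rw [Nat.factorial_succ]
    push_cast
    field_simp
    ring
  · simp

theorem hasSum_poisson_id (r : ℝ≥0) :
    HasSum (fun n : ℕ => Real.exp (-r) * r ^ n / n ! * n) r := by
  have := hasSum_poisson_mul r (g := fun _ => 1) (S := 1)
    (by simpa using hasSum_one_poissonMeasure r)
  simpa using this

theorem hasSum_poisson_sq (r : ℝ≥0) :
    HasSum (fun n : ℕ => Real.exp (-r) * r ^ n / n ! * (n : ℝ) ^ 2) (r * (r + 1)) := by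
  have := hasSum_poisson_mul r (g := fun n => n) (S := r + 1) (by
    refine ((hasSum_poisson_id r).add (hasSum_one_poissonMeasure r)).congr_fun ?_
    intro n; push_cast; ring)
  simpa [sq] using this

theorem memLp_natCast_poissonMeasure (r : ℝ≥0) :
    MemLp (fun n : ℕ => (n : ℝ)) 2 (poissonMeasure r) := by
  rw [memLp_two_iff_integrable_sq Measurable.of_discrete.aestronglyMeasurable,
    integrable_poissonMeasure_iff]
  simpa using (hasSum_poisson_sq r).summable

theorem variance_natCast_poissonMeasure (r : ℝ≥0) :
    variance (fun n : ℕ => (n : ℝ)) (poissonMeasure r) = r := by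
  rw [variance_eq_sub (memLp_natCast_poissonMeasure r), integral_poissonMeasure,
    integral_poissonMeasure]
  simp only [smul_eq_mul, Pi.pow_apply]
  rw [(hasSum_poisson_sq r).tsum_eq, (hasSum_poisson_id r).tsum_eq]
  ring

end PoissonMoments

/-! ### The Poincaré constant. -/

namespace Configuration

variable {X : Type*} [TopologicalSpace X]

theorem toNat_number_addPoint {ω : Configuration X} (hω : ω.number Set.univ ≠ ⊤) {x : X}
    (hx : x ∉ ω.carrier) :
    ((ω.addPoint x).number Set.univ).toNat = (ω.number Set.univ).toNat + 1 := by
  simp only [number, addPoint, Set.inter_univ] at hω ⊢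
  rw [Set.encard_insert_of_notMem hx, ENat.toNat_add hω (by simp)]
  simp

theorem toNat_number_removePoint {ω : Configuration X} (hω : ω.number Set.univ ≠ ⊤) {x : X}
    (hx : x ∈ ω.carrier) :
    ((ω.removePoint x).number Set.univ).toNat + 1 = (ω.number Set.univ).toNat := by
  simp only [number, removePoint, Set.inter_univ] at hω ⊢
  rw [← Set.encard_sdiff_singleton_add_one hx] at hω ⊢
  rw [ENat.toNat_add (by simpa using hω) (by simp)]
  simp

variable [MeasurableSpace X]

theorem toMeasure_addPoint {ω : Configuration X} {x : X} (hx : x ∉ ω.carrier) :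
    (ω.addPoint x).toMeasure = ω.toMeasure + Measure.dirac x := by
  ext B hB
  rw [Measure.add_apply, toMeasure_apply _ hB, toMeasure_apply _ hB, Measure.dirac_apply' _ hB]
  simp only [number, addPoint]
  by_cases hxB : x ∈ B
  · rw [Set.insert_inter_of_mem hxB, Set.encard_insert_of_notMem fun h => hx h.1]
    simp [hxB]
  · rw [Set.insert_inter_of_notMem hxB]
    simp [hxB]

/-- The gradient of a function of the number of points. -/
theorem gradNorm_toNat_number_le (σ : Measure X) {f : ℕ → ℝ} {C : ℝ} {ω : Configuration X}
    (hω : ω.number Set.univ ≠ ⊤)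
    (h1 : |f (ω.number Set.univ).toNat - f ((ω.number Set.univ).toNat + 1)| ≤ C)
    (h2 : ∀ m, m + 1 = (ω.number Set.univ).toNat → |f (m + 1) - f m| ≤ C) :
    gradNorm σ ∞ (fun ω => f (ω.number Set.univ).toNat) ω ≤ ENNReal.ofReal C := by
  rw [gradNorm, eLpNorm_exponent_top]
  refine eLpNormEssSup_le_of_ae_bound (Filter.Eventually.of_forall fun x => ?_)
  rw [Real.norm_eq_abs, grad]
  split_ifs with hx
  · have := toNat_number_removePoint hω hx
    rw [← this]
    exact h2 _ this
  · rwa [toNat_number_addPoint hω hx]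

/-- The essential supremum for (σ + ω)/2 dominates σ-almost everywhere. As ω is countable and σ has
no atoms, σ-almost every x lies outside ω, where D_x adds a point. -/
theorem lintegral_jump_le_gradNorm (σ : Measure X) [NullSingletonClass σ] (G : Measure X → ℝ)
    (ω : Configuration X) :
    ∫⁻ x, ENNReal.ofReal ((G (ω.toMeasure + Measure.dirac x) - G ω.toMeasure) ^ 2) ∂σ ≤
      σ Set.univ * gradNorm σ ∞ (G ∘ toMeasure) ω ^ 2 := by
  have h1 : ∀ᵐ x ∂σ, ‖grad (G ∘ toMeasure) ω x‖ₑ ≤ gradNorm σ ∞ (G ∘ toMeasure) ω := by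
    have h := ae_le_eLpNormEssSup (f := grad (G ∘ toMeasure) ω)
      (μ := (2⁻¹ : ℝ≥0∞) • (σ + ω.toMeasure))
    rw [Measure.ae_ennreal_smul_measure_iff (by simp), ae_add_measure_iff] at h
    exact h.1
  have h2 : ∀ᵐ x ∂σ, x ∉ ω.carrier := measure_eq_zero_iff_ae_notMem.1 (ω.countable.measure_zero σ)
  refine (lintegral_mono_ae (g := fun _ => gradNorm σ ∞ (G ∘ toMeasure) ω ^ 2) ?_).trans_eq
    (by rw [lintegral_const, mul_comm])
  filter_upwards [h1, h2] with x hx hxω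
  refine le_trans (le_of_eq ?_) (pow_le_pow_left' hx 2)
  rw [grad, if_neg hxω, Function.comp_apply, Function.comp_apply, toMeasure_addPoint hxω,
    Real.enorm_eq_ofReal_abs, ← ENNReal.ofReal_pow (abs_nonneg _), sq_abs, ← sq_abs (_ - _),
    abs_sub_comm, sq_abs]

variable {σ : Measure X} {π : Measure (Configuration X)}

/-- The Poincaré inequality for the Poisson measure. -/
theorem IsPoissonMeasure.evariance_le (hπ : IsPoissonMeasure σ π) [IsFiniteMeasure σ]
    [NullSingletonClass σ] {F : Configuration X → ℝ} (hF : Measurable F) (hF2 : MemLp F 2 π) :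
    evariance F π ≤ σ Set.univ * ∫⁻ ω, gradNorm σ ∞ F ω ^ 2 ∂π := by
  have := hπ.isProbabilityMeasure
  have := isProbabilityMeasure_poissonLaw σ zero_le_one
  obtain ⟨G, hG, rfl⟩ := exists_eq_comp_toMeasure hF
  have hG2 : MemLp G 2 (poissonLaw σ 1) := by
    rw [← hπ.map_toMeasure]
    exact (memLp_map_measure_iff hG.aestronglyMeasurable measurable_toMeasure.aemeasurable).2 hF2
  have h := evariance_poissonLaw_le σ hG hG2
  rw [← hG2.ofReal_variance_eq, ← hπ.map_toMeasure, variance_map hG.aemeasurable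
    measurable_toMeasure.aemeasurable, lintegral_map (measurable_jump σ hG) measurable_toMeasure,
    hF2.ofReal_variance_eq] at h
  rw [← lintegral_const_mul' _ _ (measure_ne_top σ _)]
  exact h.trans (lintegral_mono fun ω => lintegral_jump_le_gradNorm σ G ω)

theorem IsPoissonMeasure.evariance_toNat_number (hπ : IsPoissonMeasure σ π) [IsFiniteMeasure σ] :
    MemLp (fun ω : Configuration X => ((ω.number Set.univ).toNat : ℝ)) 2 π ∧
      evariance (fun ω : Configuration X => ((ω.number Set.univ).toNat : ℝ)) π = σ Set.univ := by
  have := hπ.isProbabilityMeasure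
  have hm := measurable_toNat_number (X := X) MeasurableSet.univ
  have h1 := memLp_natCast_poissonMeasure (σ Set.univ).toNNReal
  have h2 := variance_natCast_poissonMeasure (σ Set.univ).toNNReal
  rw [← hπ.map_toNat_number_univ] at h1 h2
  have h3 := (memLp_map_measure_iff Measurable.of_discrete.aestronglyMeasurable
    hm.aemeasurable).1 h1
  rw [variance_map Measurable.of_discrete.aemeasurable hm.aemeasurable] at h2
  refine ⟨h3, ?_⟩
  have h4 := h3.ofReal_variance_eq
  rw [h2] at h4
  exact h4.symm.trans (by simp)

theorem IsPoissonMeasure.poincareConstant_eq (hπ : IsPoissonMeasure σ π) [IsFiniteMeasure σ]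
    [NullSingletonClass σ] (hσ : σ ≠ 0) :
    poincareConstant σ π ∞ = 1 / σ Set.univ := by
  have := hπ.isProbabilityMeasure
  have hσ0 : σ Set.univ ≠ 0 := by simpa using hσ
  refine le_antisymm ?_ ?_
  · obtain ⟨h1, h2⟩ := hπ.evariance_toNat_number
    refine (iInf₂_le_of_le (fun ω => ((ω.number Set.univ).toNat : ℝ))
      (Measurable.of_discrete.comp (measurable_toNat_number MeasurableSet.univ)) 
      (iInf₂_le_of_le h1 (by rwa [h2]) le_rfl)).trans ?_
    rw [h2]
    refine ENNReal.div_le_div_right ?_ _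
    calc ∫⁻ ω, gradNorm σ ∞ (fun ω => ((ω.number Set.univ).toNat : ℝ)) ω ^ 2 ∂π
        ≤ ∫⁻ _, 1 ∂π := by
          refine lintegral_mono_ae (hπ.ae_number_univ_ne_top.mono fun ω hω => ?_)
          have := gradNorm_toNat_number_le σ (f := fun n => (n : ℝ)) (C := 1) hω (by simp)
            (by simp)
          rw [ENNReal.ofReal_one] at this
          exact pow_le_one' this 2
      _ = 1 := by simp
  · refine le_iInf₂ fun F hF => le_iInf₂ fun hF2 hF0 => ?_
    have h := hπ.evariance_le hF hF2
    have hfin : evariance F π ≠ ∞ := (evariance_lt_top hF2).ne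
    rw [ENNReal.le_div_iff_mul_le (Or.inl hF0) (Or.inl hfin), mul_comm, mul_one_div]
    exact ENNReal.div_le_of_le_mul' h

end Configuration

/-! ### Vertex isoperimetry of the Poisson distribution on ℕ. -/

section VertexBoundary

open scoped NNReal

/-- The two-sided vertex boundary of a set of natural numbers. -/
def vertexBoundary (S : Set ℕ) : Set ℕ :=
  {n | ¬(n ∈ S ↔ n + 1 ∈ S) ∨ ∃ m, m + 1 = n ∧ ¬(n ∈ S ↔ m ∈ S)}

theorem vertexBoundary_Iic_subset (k : ℕ) :
    vertexBoundary {n | n ≤ k} ⊆ {k, k + 1} := by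
  intro n hn
  simp only [Set.mem_insert_iff, Set.mem_singleton_iff]
  rcases hn with h | ⟨m, rfl, h⟩ <;> simp only [Set.mem_ofPred_eq] at h <;> omega

theorem vertexBoundary_Ici_diff_subset (k j : ℕ) :
    vertexBoundary {n | k + 1 ≤ n ∧ n ≠ j + 1} ⊆ {k, k + 1} ∪ {j, j + 1, j + 2} := by
  intro n hn
  simp only [Set.mem_union, Set.mem_insert_iff, Set.mem_singleton_iff]
  rcases hn with h | ⟨m, rfl, h⟩ <;> simp only [Set.mem_ofPred_eq] at h <;> omega

/-- The square d² is the sum of the first d odd numbers: a layer-cake formula turning tail bounds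
into second moments. -/
theorem tsum_odd_mul_indicator (d : ℕ) :
    ∑' j : ℕ, (2 * j + 1 : ℝ≥0∞) * (if j + 1 ≤ d then 1 else 0) = (d : ℝ≥0∞) ^ 2 := by
  rw [tsum_eq_sum (s := Finset.range d) fun j hj => by
    rw [if_neg (by simpa using hj), mul_zero]]
  rw [Finset.sum_congr rfl fun j hj => by
    rw [if_pos (by simpa using hj), mul_one]]
  induction d with
  | zero => simp
  | succ d ih =>
    rw [Finset.sum_range_succ, ih]
    push_cast
    ring

theorem tsum_odd_mul_boundary_le (d : ℕ) :
    ∑' j : ℕ, (2 * j + 1 : ℝ≥0∞) *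
      ((if d = j then 1 else 0) + (if d = j + 1 then 1 else 0) + (if j = 0 then 1 else 0)) ≤
        4 * d + 2 := by
  simp_rw [mul_add]
  rw [ENNReal.tsum_add, ENNReal.tsum_add, tsum_eq_single d fun j hj => by simp [hj.symm],
    tsum_eq_single (d - 1) fun j hj => by rw [if_neg (by omega), mul_zero],
    tsum_eq_single 0 fun j hj => by simp [hj]]
  -- For d = 0 the truncated d − 1 does not satisfy the condition and the term vanishes; otherwise
  -- it is 2d − 1.
  have h : (2 * ((d - 1 : ℕ) : ℝ≥0∞) + 1) * (if d = d - 1 + 1 then 1 else 0) ≤ 2 * d := by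
    split_ifs with hd
    · rw [mul_one]
      norm_cast
      omega
    · simp
  refine (add_le_add_left (add_le_add_right h _) _).trans_eq ?_
  simp
  ring

/-- If the tails of `d` are controlled by the mass at the ends of the tails, then so is the second
moment by the first one. -/
theorem mul_lintegral_sq_le_of_tail {μ : Measure ℕ} [IsProbabilityMeasure μ] {d : ℕ → ℕ}
    {C : ℝ≥0∞}
    (h : ∀ j, C * μ {n | j + 1 ≤ d n} ≤
      μ {n | d n = j} + μ {n | d n = j + 1} + (if j = 0 then 1 else 0)) :
    C * ∫⁻ n, (d n : ℝ≥0∞) ^ 2 ∂μ ≤ 4 * ∫⁻ n, (d n : ℝ≥0∞) ∂μ + 2 := by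
  have hi : ∀ p : ℕ → Prop, ∀ [DecidablePred p],
      ∫⁻ n, (if p n then (1 : ℝ≥0∞) else 0) ∂μ = μ {n | p n} := fun p _ => by
    rw [← lintegral_indicator_one (MeasurableSet.of_discrete)]
    refine lintegral_congr fun n => ?_
    simp [Set.indicator]
  calc C * ∫⁻ n, (d n : ℝ≥0∞) ^ 2 ∂μ
      = ∑' j : ℕ, (2 * j + 1 : ℝ≥0∞) * (C * μ {n | j + 1 ≤ d n}) := by
        simp_rw [← tsum_odd_mul_indicator]
        rw [lintegral_tsum fun j => Measurable.of_discrete.aemeasurable, ← ENNReal.tsum_mul_left]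
        refine tsum_congr fun j => ?_
        rw [lintegral_const_mul _ Measurable.of_discrete, hi]
        ring
    _ ≤ ∑' j : ℕ, (2 * j + 1 : ℝ≥0∞) *
          (μ {n | d n = j} + μ {n | d n = j + 1} + (if j = 0 then 1 else 0)) :=
        ENNReal.tsum_le_tsum fun j => mul_le_mul_right (h j) _
    _ = ∫⁻ n, ∑' j : ℕ, (2 * j + 1 : ℝ≥0∞) * ((if d n = j then 1 else 0) +
          (if d n = j + 1 then 1 else 0) + (if j = 0 then 1 else 0)) ∂μ := by
        rw [lintegral_tsum fun j => Measurable.of_discrete.aemeasurable]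
        refine tsum_congr fun j => ?_
        rw [lintegral_const_mul _ Measurable.of_discrete,
          lintegral_add_left Measurable.of_discrete, lintegral_add_left Measurable.of_discrete,
          hi, hi]
        simp
    _ ≤ ∫⁻ n, (4 * d n + 2 : ℝ≥0∞) ∂μ := lintegral_mono fun n => tsum_odd_mul_boundary_le (d n)
    _ = _ := by
        rw [lintegral_add_left Measurable.of_discrete, lintegral_const_mul _ Measurable.of_discrete]
        simp

/-- For the least m with μ{n ≤ m} ≥ 1/2, minimality makes the half-lines below m strictly smaller
than 1/2. Above m equality can occur, hence the approximation in `mul_measure_Ici_le`. -/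
theorem exists_median (μ : Measure ℕ) [IsProbabilityMeasure μ] :
    ∃ m : ℕ, (∀ k, k < m → μ {n | n ≤ k} < 1 / 2) ∧ μ {n | m + 1 ≤ n} ≤ 1 / 2 := by
  classical
  have hex : ∃ m : ℕ, 1 / 2 ≤ μ {n | n ≤ m} := by
    have ht : Filter.Tendsto (fun m : ℕ => μ {n | n ≤ m}) Filter.atTop
        (nhds (μ (⋃ m : ℕ, {n | n ≤ m}))) :=
      tendsto_measure_iUnion_atTop fun a b hab n (hn : n ≤ a) => hn.trans hab
    have hU : (⋃ m : ℕ, {n | n ≤ m}) = Set.univ :=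
      Set.eq_univ_of_forall fun n => Set.mem_iUnion.2 ⟨n, le_refl n⟩
    rw [hU, measure_univ] at ht
    have hlt : (1 / 2 : ℝ≥0∞) < 1 := by simp
    exact (ht.eventually (lt_mem_nhds hlt)).exists.imp fun m hm => hm.le
  refine ⟨Nat.find hex, fun k hk => not_le.1 (Nat.find_min hex hk), ?_⟩
  have h := Nat.find_spec hex
  have hc : {n | Nat.find hex + 1 ≤ n} = {n | n ≤ Nat.find hex}ᶜ := by
    ext n; simp
  rw [hc, prob_compl_eq_one_sub MeasurableSet.of_discrete]
  refine (tsub_le_tsub_left h 1).trans_eq ?_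
  simp

theorem tendsto_measure_singleton_atTop (μ : Measure ℕ) [IsFiniteMeasure μ] :
    Filter.Tendsto (fun j : ℕ => μ {j}) Filter.atTop (nhds 0) := by
  refine ENNReal.tendsto_atTop_zero_of_tsum_ne_top ?_
  rw [← measure_iUnion (fun i j hij => by simpa using hij) fun k => measurableSet_singleton k]
  exact measure_ne_top _ _

/-- An isoperimetric inequality for sets of measure less than `1 / 2` extends to half-lines of
measure at most `1 / 2`. -/
theorem mul_measure_Ici_le {μ : Measure ℕ} [IsProbabilityMeasure μ] (hpos : ∀ j, 0 < μ {j})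
    {C : ℝ≥0∞} (hC : C ≠ ∞) (h : ∀ S, μ S < 1 / 2 → C * μ S ≤ μ (vertexBoundary S)) {k : ℕ}
    (hk : μ {n | k + 1 ≤ n} ≤ 1 / 2) :
    C * μ {n | k + 1 ≤ n} ≤ μ {k} + μ {k + 1} := by
  have ht := tendsto_measure_singleton_atTop μ
  have hlim : Filter.Tendsto (fun j : ℕ => μ {k} + μ {k + 1} + (μ {j} + (μ {j + 1} + μ {j + 2})) +
      C * μ {j + 1}) Filter.atTop
      (nhds (μ {k} + μ {k + 1} + (0 + (0 + 0)) + C * 0)) :=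
    (tendsto_const_nhds.add (ht.add (((Filter.tendsto_add_atTop_iff_nat 1).2 ht).add
      ((Filter.tendsto_add_atTop_iff_nat 2).2 ht)))).add
      (ENNReal.Tendsto.const_mul ((Filter.tendsto_add_atTop_iff_nat 1).2 ht) (Or.inr hC))
  simp only [add_zero, mul_zero] at hlim
  refine ge_of_tendsto hlim ?_
  -- Deleting the point j + 1, of positive mass, brings the half-line strictly below 1/2. The cost
  -- is the mass of that point and of j, j + 1, j + 2 in the boundary, which vanishes as j → ∞.
  filter_upwards [Filter.eventually_ge_atTop k] with j hj
  have hsplit : μ {n | k + 1 ≤ n} = μ {n | k + 1 ≤ n ∧ n ≠ j + 1} + μ {j + 1} := by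
    rw [← measure_union _ (measurableSet_singleton _)]
    · congr 1
      ext n
      simp only [Set.mem_ofPred_eq, Set.mem_union, Set.mem_singleton_iff]
      omega
    · simp
  have hlt : μ {n | k + 1 ≤ n ∧ n ≠ j + 1} < 1 / 2 := by
    refine lt_of_lt_of_le ?_ hk
    rw [hsplit]
    exact ENNReal.lt_add_right (measure_ne_top _ _) (hpos _).ne'
  have h1 := h _ hlt
  rw [hsplit, mul_add]
  refine add_le_add_left (h1.trans ((measure_mono (vertexBoundary_Ici_diff_subset k j)).trans
    ((measure_union_le _ _).trans (add_le_add ?_ ?_)))) _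
  · exact measure_union_le {k} {k + 1}
  · refine (measure_union_le {j} {j + 1, j + 2}).trans (add_le_add_right ?_ _)
    exact measure_union_le {j + 1} {j + 2}

theorem exists_mul_lintegral_sq_le {μ : Measure ℕ} [IsProbabilityMeasure μ]
    (hpos : ∀ j, 0 < μ {j}) {C : ℝ≥0∞} (hC : C ≠ ∞)
    (h : ∀ S, μ S < 1 / 2 → C * μ S ≤ μ (vertexBoundary S)) :
    ∃ m : ℕ, C * ∫⁻ n, ENNReal.ofReal (((n : ℝ) - m) ^ 2) ∂μ ≤
      4 * ∫⁻ n, ENNReal.ofReal |(n : ℝ) - m| ∂μ + 2 := by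
  obtain ⟨m, hm1, hm2⟩ := exists_median μ
  refine ⟨m, ?_⟩
  -- With truncated subtraction, this sum is |n − m|. Each set {d ≥ j + 1} is an upper and a lower
  -- tail, with boundaries inside {d = j} and {d = j + 1}.
  have key := mul_lintegral_sq_le_of_tail (μ := μ) (d := fun n => (n - m) + (m - n)) (C := C) ?_
  · have hd : ∀ n : ℕ, |(n : ℝ) - m| = (((n - m) + (m - n) : ℕ) : ℝ) := fun n => by
      rcases le_total n m with hn | hn
      · rw [Nat.sub_eq_zero_of_le hn, zero_add, Nat.cast_sub hn, abs_sub_comm,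
          abs_of_nonneg (by simpa using hn)]
      · rw [Nat.sub_eq_zero_of_le hn, add_zero, Nat.cast_sub hn,
          abs_of_nonneg (by simpa using hn)]
    simp_rw [← sq_abs ((_ : ℝ) - m), hd, ENNReal.ofReal_pow (Nat.cast_nonneg _),
      ENNReal.ofReal_natCast]
    exact key
  · intro j
    have hupper : C * μ {n | m + j + 1 ≤ n} ≤ μ {m + j} + μ {m + j + 1} :=
      mul_measure_Ici_le hpos hC h ((measure_mono fun n (hn : m + j + 1 ≤ n) =>
        show m + 1 ≤ n by omega).trans hm2)
    have hlower : C * μ {n | n + j + 1 ≤ m} ≤ μ {n | n + j = m} + μ {n | n + j + 1 = m} := by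
      rcases Nat.lt_or_ge j m with hj | hj
      · have e : {n | n + j + 1 ≤ m} = {n | n ≤ m - j - 1} := by
          ext n; simp only [Set.mem_ofPred_eq]; omega
        rw [e]
        refine (h _ (hm1 _ (by omega))).trans ((measure_mono (vertexBoundary_Iic_subset _)).trans
          ((measure_union_le {m - j - 1} {m - j - 1 + 1}).trans_eq ?_))
        rw [add_comm]
        congr 2 <;> (ext n; simp only [Set.mem_ofPred_eq, Set.mem_singleton_iff]; omega)
      · have e : {n | n + j + 1 ≤ m} = ∅ := by
          ext n; simp only [Set.mem_ofPred_eq, Set.mem_empty_iff_false, iff_false]; omega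
        rw [e, measure_empty, mul_zero]
        exact zero_le
    have e1 : {n | j + 1 ≤ (n - m) + (m - n)} = {n | m + j + 1 ≤ n} ∪ {n | n + j + 1 ≤ m} := by
      ext n; simp only [Set.mem_ofPred_eq, Set.mem_union]; omega
    have e2 : μ {m + j + 1} + μ {n | n + j + 1 = m} = μ {n | (n - m) + (m - n) = j + 1} := by
      rw [← measure_union _ MeasurableSet.of_discrete]
      · congr 1
        ext n; simp only [Set.mem_ofPred_eq, Set.mem_union, Set.mem_singleton_iff]; omega
      · rw [Set.disjoint_singleton_left]
        simp only [Set.mem_ofPred_eq]; omega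
    -- At j = 0 both tails have m in their boundary bound; the extra 1 pays for the double count.
    have e3 : μ {m + j} + μ {n | n + j = m} ≤
        μ {n | (n - m) + (m - n) = j} + (if j = 0 then 1 else 0) := by
      split_ifs with hj
      · refine add_le_add (measure_mono ?_) prob_le_one
        rintro n rfl
        simp only [Set.mem_ofPred_eq]; omega
      · rw [← measure_union _ MeasurableSet.of_discrete, add_zero]
        · refine measure_mono fun n hn => ?_
          simp only [Set.mem_ofPred_eq, Set.mem_union, Set.mem_singleton_iff] at hn ⊢; omega
        · rw [Set.disjoint_singleton_left]
          simp only [Set.mem_ofPred_eq]; omega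
    calc C * μ {n | j + 1 ≤ (n - m) + (m - n)}
        ≤ C * μ {n | m + j + 1 ≤ n} + C * μ {n | n + j + 1 ≤ m} := by
          rw [e1, ← mul_add]
          exact mul_le_mul_right (measure_union_le _ _) _
      _ ≤ (μ {m + j} + μ {m + j + 1}) + (μ {n | n + j = m} + μ {n | n + j + 1 = m}) :=
          add_le_add hupper hlower
      _ = (μ {m + j} + μ {n | n + j = m}) + (μ {m + j + 1} + μ {n | n + j + 1 = m}) := by ring
      _ ≤ (μ {n | (n - m) + (m - n) = j} + (if j = 0 then 1 else 0)) +
          μ {n | (n - m) + (m - n) = j + 1} := by rw [e2]; exact add_le_add_left e3 _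
      _ = _ := by ring

/-- The vertex isoperimetric constant of the Poisson distribution is at most `4 / √r + 2 / r`. -/
theorem le_of_isoperimetric_poissonMeasure {r : ℝ≥0} (hr : 0 < r) {c : ℝ} (hc : 0 ≤ c)
    (h : ∀ S, poissonMeasure r S < 1 / 2 →
      ENNReal.ofReal c * poissonMeasure r S ≤ poissonMeasure r (vertexBoundary S)) :
    c ≤ 4 / √r + 2 / r := by
  set μ := poissonMeasure r with hμ
  have hpos : ∀ j, 0 < μ {j} := fun j => by
    have := poissonMeasure_real_singleton_pos j hr
    exact pos_iff_ne_zero.2 fun h0 => by simp [Measure.real, ← hμ, h0] at this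
  obtain ⟨m, hm⟩ := exists_mul_lintegral_sq_le hpos ENNReal.ofReal_ne_top h
  have hL := memLp_natCast_poissonMeasure r
  rw [← hμ] at hL
  have hY : MemLp (fun n : ℕ => (n : ℝ) - m) 2 μ := hL.sub (memLp_const _)
  have hYa : MemLp (fun n : ℕ => |(n : ℝ) - m|) 2 μ := hY.abs
  have hi1 : Integrable (fun n : ℕ => |(n : ℝ) - m|) μ := hYa.integrable one_le_two
  have hi2 : Integrable (fun n : ℕ => ((n : ℝ) - m) ^ 2) μ := hY.integrable_sq
  rw [← ofReal_integral_eq_lintegral_ofReal hi1 (Filter.Eventually.of_forall fun n => abs_nonneg _),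
    ← ofReal_integral_eq_lintegral_ofReal hi2 (Filter.Eventually.of_forall fun n => sq_nonneg _)]
    at hm
  set V := ∫ n : ℕ, ((n : ℝ) - m) ^ 2 ∂μ with hV
  set E := ∫ n : ℕ, |(n : ℝ) - m| ∂μ with hE
  have hE0 : 0 ≤ E := integral_nonneg fun n => abs_nonneg _
  -- The second moment about m is at least the variance.
  have hVr : r ≤ V := by
    rw [← variance_natCast_poissonMeasure r,
      ← variance_sub_const hL.aestronglyMeasurable (m : ℝ)]
    exact variance_le_expectation_sq hY.aestronglyMeasurable
  have hEV : E ^ 2 ≤ V := by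
    have h1 := variance_nonneg (fun n : ℕ => |(n : ℝ) - m|) μ
    rw [variance_eq_sub hYa] at h1
    have h2 : ∫ n : ℕ, ((fun n : ℕ => |(n : ℝ) - m|) ^ 2) n ∂μ = V := by
      simp only [Pi.pow_apply, sq_abs, hV]
    linarith
  have hm' : c * V ≤ 4 * E + 2 := by
    have h4 : (4 : ℝ≥0∞) = ENNReal.ofReal 4 := by simp
    have h2 : (2 : ℝ≥0∞) = ENNReal.ofReal 2 := by simp
    rw [← ENNReal.ofReal_mul hc, h4, h2, ← ENNReal.ofReal_mul (by norm_num),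
      ← ENNReal.ofReal_add (by positivity) (by norm_num),
      ENNReal.ofReal_le_ofReal_iff (by positivity)] at hm
    exact hm
  have hr0 : (0 : ℝ) < r := hr
  have hV0 : 0 < V := hr0.trans_le hVr
  have hEs : E ≤ √V := Real.le_sqrt_of_sq_le hEV
  have hcV : c ≤ 4 / √V + 2 / V := by
    rw [← mul_le_mul_iff_left₀ hV0, add_mul, div_mul_cancel₀ _ hV0.ne']
    have : 4 / √V * V = 4 * √V := by
      nth_rewrite 2 [← Real.mul_self_sqrt hV0.le]
      have := (Real.sqrt_pos.2 hV0).ne'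
      field_simp
    rw [this]
    linarith
  refine hcV.trans (add_le_add ?_ ?_)
  · exact div_le_div_of_nonneg_left (by norm_num) (Real.sqrt_pos.2 hr0) (Real.sqrt_le_sqrt hVr)
  · exact div_le_div_of_nonneg_left (by norm_num) hr0 hVr

end VertexBoundary

/-! ### Upper bound for the isoperimetric constant. -/

namespace Configuration

variable {X : Type*} [TopologicalSpace X] [MeasurableSpace X] {σ : Measure X}
  {π : Measure (Configuration X)}

/-- The boundary of a set of configurations determined by the number of points. -/
theorem gradNorm_indicator_toNat_number_le (σ : Measure X) (S : Set ℕ) {ω : Configuration X}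
    (hω : ω.number Set.univ ≠ ⊤) :
    gradNorm σ ∞ ({ω : Configuration X | (ω.number Set.univ).toNat ∈ S}.indicator fun _ => 1) ω ≤
      {ω : Configuration X | (ω.number Set.univ).toNat ∈ vertexBoundary S}.indicator 1 ω := by
  have hf : ({ω : Configuration X | (ω.number Set.univ).toNat ∈ S}.indicator fun _ => (1 : ℝ)) =
      fun ω => S.indicator (fun _ => (1 : ℝ)) (ω.number Set.univ).toNat := by
    funext ω; simp [Set.indicator]
  have hle : ∀ a b : ℕ,
      |S.indicator (fun _ => (1 : ℝ)) a - S.indicator (fun _ => (1 : ℝ)) b| ≤ 1 := fun a b => by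
    by_cases ha : a ∈ S <;> by_cases hb : b ∈ S <;> simp [ha, hb]
  have heq : ∀ a b : ℕ, (a ∈ S ↔ b ∈ S) →
      |S.indicator (fun _ => (1 : ℝ)) a - S.indicator (fun _ => (1 : ℝ)) b| ≤ 0 :=
    fun a b hab => by by_cases hb : b ∈ S <;> simp [hab, hb]
  rw [hf]
  by_cases hω' : (ω.number Set.univ).toNat ∈ vertexBoundary S
  · rw [Set.indicator_of_mem
      (s := {ω : Configuration X | (ω.number Set.univ).toNat ∈ vertexBoundary S}) hω']
    simpa using gradNorm_toNat_number_le σ (C := 1) hω (hle _ _) fun m _ => hle _ _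
  · rw [Set.indicator_of_notMem
      (s := {ω : Configuration X | (ω.number Set.univ).toNat ∈ vertexBoundary S}) hω']
    simp only [vertexBoundary, Set.mem_ofPred_eq, not_or, not_not, not_exists, not_and] at hω'
    simpa using gradNorm_toNat_number_le σ (C := 0) hω (heq _ _ hω'.1) fun m hm =>
      heq _ _ (by have := hω'.2 m hm; rwa [← hm] at this)

/-- Test sets {N ∈ S}: N is Poisson, and the boundary of such a set lies almost surely in {N ∈ ∂S}.
-/
theorem IsPoissonMeasure.isoperimetricConstant_mul_le (hπ : IsPoissonMeasure σ π) {S : Set ℕ}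
    (hS : poissonMeasure (σ Set.univ).toNNReal S < 1 / 2) :
    isoperimetricConstant σ π ∞ * poissonMeasure (σ Set.univ).toNNReal S ≤
      poissonMeasure (σ Set.univ).toNNReal (vertexBoundary S) := by
  have := hπ.isProbabilityMeasure
  have hm := measurable_toNat_number (X := X) MeasurableSet.univ
  have hmap : ∀ T : Set ℕ, poissonMeasure (σ Set.univ).toNNReal T =
      π {ω | (ω.number Set.univ).toNat ∈ T} := fun T => by
    rw [← hπ.map_toNat_number_univ, Measure.map_apply hm MeasurableSet.of_discrete]
    rfl
  rw [hmap] at hS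
  rw [hmap, hmap]
  rcases eq_or_ne (π {ω | (ω.number Set.univ).toNat ∈ S}) 0 with h0 | h0
  · rw [h0, mul_zero]
    exact zero_le
  have hms : ∀ T : Set ℕ, MeasurableSet {ω : Configuration X | (ω.number Set.univ).toNat ∈ T} :=
    fun T => hm MeasurableSet.of_discrete
  rw [← ENNReal.le_div_iff_mul_le (Or.inl h0) (Or.inl (measure_ne_top _ _))]
  refine (iInf₂_le_of_le _ (hms S) (iInf₂_le_of_le (pos_iff_ne_zero.2 h0) hS le_rfl)).trans ?_
  refine ENNReal.div_le_div_right ?_ _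
  rw [← lintegral_indicator_one (hms (vertexBoundary S))]
  exact lintegral_mono_ae (hπ.ae_number_univ_ne_top.mono fun ω hω =>
    gradNorm_indicator_toNat_number_le σ S hω)

theorem IsPoissonMeasure.isoperimetricConstant_le (hπ : IsPoissonMeasure σ π) [IsFiniteMeasure σ]
    (hσ : σ ≠ 0) :
    isoperimetricConstant σ π ∞ ≤
      ENNReal.ofReal (4 / √(σ.real Set.univ) + 2 / σ.real Set.univ) := by
  have hr : 0 < (σ Set.univ).toNNReal :=
    ENNReal.toNNReal_pos (by simpa using hσ) (measure_ne_top _ _)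
  by_contra! hlt
  -- The constant could a priori be infinite, so a finite c below it is used.
  obtain ⟨c, hc1, hc2⟩ := ENNReal.lt_iff_exists_nnreal_btwn.1 hlt
  have h := le_of_isoperimetric_poissonMeasure hr c.2 fun S hS => by
    refine le_trans ?_ (hπ.isoperimetricConstant_mul_le hS)
    refine mul_le_mul_left ?_ _
    exact (ENNReal.ofReal_coe_nnreal (p := c)).trans_le hc2.le
  exact hc1.not_ge ((ENNReal.ofReal_coe_nnreal (p := c)).symm.trans_le
    (ENNReal.ofReal_le_ofReal h))

end Configuration

/-! ### Conclusion. -/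

theorem mainTheorem9 {X : Type*} [MetricSpace X] [MeasurableSpace X] [BorelSpace X]
    (σ : Measure X) [IsFiniteMeasure σ] [NullSingletonClass σ] (hσ : σ ≠ 0)
    (π : Measure (Configuration X)) (hπ : Configuration.IsPoissonMeasure σ π) :
    Configuration.poincareConstant σ π ∞ = 1 / σ Set.univ ∧
      ((Configuration.isoperimetricConstant σ π ∞ + 1) ^ (1 / 2 : ℝ) - 1) ^ 2 / 4 ≤
        Configuration.poincareConstant σ π ∞ := by
  have hl := hπ.poincareConstant_eq hσ
  refine ⟨hl, ?_⟩
  rw [hl]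
  set r := σ.real Set.univ with hr
  have hr0 : 0 < r := ENNReal.toReal_pos (by simpa using hσ) (measure_ne_top _ _)
  have hs0 : 0 < √r := Real.sqrt_pos.2 hr0
  have h1 : Configuration.isoperimetricConstant σ π ∞ + 1 ≤
      ENNReal.ofReal ((1 + 2 / √r) ^ 2) := by
    refine (add_le_add_left (hπ.isoperimetricConstant_le hσ) 1).trans ?_
    rw [← ENNReal.ofReal_one, ← ENNReal.ofReal_add (by positivity) zero_le_one]
    refine ENNReal.ofReal_le_ofReal ?_
    have e : (1 + 2 / √r) ^ 2 = 1 + 4 / √r + 4 / r := by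
      rw [add_sq, div_pow, Real.sq_sqrt hr0.le]
      ring
    -- Weakening 2/r to 4/r completes the square (1 + 2/√r)².
    have : 2 / r ≤ 4 / r := by gcongr; norm_num
    rw [e]
    linarith
  -- The subtraction in `ℝ≥0∞` truncates nothing, since h_∞ + 1 ≥ 1.
  have h2 : (Configuration.isoperimetricConstant σ π ∞ + 1) ^ (1 / 2 : ℝ) - 1 ≤
      ENNReal.ofReal (2 / √r) := by
    refine tsub_le_iff_left.2 ((ENNReal.rpow_le_rpow h1 (by norm_num)).trans_eq ?_)
    rw [ENNReal.ofReal_rpow_of_nonneg (by positivity) (by norm_num), ← Real.sqrt_eq_rpow,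
      Real.sqrt_sq (by positivity), ENNReal.ofReal_add zero_le_one (by positivity),
      ENNReal.ofReal_one]
  refine (ENNReal.div_le_div_right (pow_le_pow_left' h2 2) 4).trans_eq ?_
  have h4 : (4 : ℝ≥0∞) = ENNReal.ofReal 4 := by simp
  rw [← ENNReal.ofReal_pow (by positivity), h4, ← ENNReal.ofReal_div_of_pos (by norm_num),
    ← ofReal_measureReal (μ := σ), ← hr, ← ENNReal.ofReal_one, ← ENNReal.ofReal_div_of_pos hr0,
    div_pow, Real.sq_sqrt hr0.le]
  congr 1
  field_simp
  norm_num
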